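/- **Setting.** A target dataset is a finite list $\mathcal D=(x_i,y_i)_{i=1}^{n}$ with $x_i\in\mathbb R^{d}$, $y_i\in\mathbb R$. Two datasets are *neighbours* if they differ in a single entry, i.e. one is obtained from the other by replacing, inserting or removing one entry. A randomized mechanism $\mathcal M$ is $(\varepsilon,\delta)$-differentially private with respect to an adjacency relation if $\Pr[\mathcal M(\mathcal D)\in S]\le e^{\varepsilon}\Pr[\mathcal M(\mathcal D')\in S]+\delta$ for all adjacent $\mathcal D,\mathcal D'$ and all measurable $S$. **The DP-KIP algorithm.** Fix a kernel $k:\mathbb R^d\times\mathbb R^d\to\mathbb R$, a number $m$ of distilled points, $c\ge 1$ classes with scalar labels $\ell_1,\dots,\ell_c$, a ridge parameter $\lambda$ (a constant, or a function of the distilled inputs such as $\lambda_0\operatorname{tr}(K_{ss})/m$), a number $P\ge 0$ of iterations, a minibatch size $B\ge 1$, a clipping norm $C>0$, step sizes $\eta_1,\dots,\eta_P\in\mathbb R$, and a noise parameter $\sigma>0$. On a target dataset $\mathcal D$ of size $N\ge B$: 1. Draw $X_s=(x_{s_1},\dots,x_{s_m})$ with independent $x_{s_j}\sim\mathcal N(0,I_d)$,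 and draw the labels $y_{s_1},\dots,y_{s_m}$ independently, each being the label of a uniformly random class; the labels $y_s$ stay fixed. 2. For $p=1,\dots,P$, with fresh independent randomness: draw a uniformly random $B$-element subset $J$ of the $N$ entries (without replacement). For $l\in J$ compute the gradient with respect to $X_s\in\mathbb R^{m\times d}$ $$g_l=\nabla_{X_s}\bigl(y_l-\mathbf k_{ls}^{\top}(K_{ss}+\lambda I)^{-1}y_s\bigr)^2,\qquad (K_{ss})_{ij}=k(x_{s_i},x_{s_j}),\quad (\mathbf k_{ls})_j=k(x_l,x_{s_j}),$$ (a gradient or an inverse matrix that does not exist is read as $0$), clip it, $\hat g_l=g_l/\max(1,\|g_l\|_2/C)$, add noise, $\tilde g=\sum_{l\in J}\hat g_l+\mathcal N(0,\sigma^2C^2I)$, and make the SGD step $X_s\leftarrow X_s-\eta_p\,\tilde g/B$. 3. Return the distilled dataset $(x_{s_j},y_{s_j})_{j=1}^m$. **Calibration of $\sigma$.** Let $\gamma=B/n$. The base mechanism adds $\mathcal N(0,\sigma^2C^2I)$ to a sum of $B$ vectors of norm at most $C$; such a sum has $\ell^2$-sensitivity $\Delta=2C$ under the exchange of one element of the minibatch,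 so the Gaussian mechanism has the Rényi-DP curve $e(\alpha)=\alpha\Delta^2/(2\sigma^2C^2)=2\alpha/\sigma^2$. For integers $\alpha\ge 2$ the subsampled Rényi-DP parameter of one iteration is $$e'(\alpha)=\min\Bigl\{e(\alpha),\ \tfrac1{\alpha-1}\log\Bigl(1+\gamma^2\tbinom{\alpha}{2}\min\{4(e^{e(2)}-1),\,2e^{e(2)}\}+\sum_{j=3}^{\alpha}2\gamma^j\tbinom{\alpha}{j}e^{(j-1)e(j)}\Bigr)\Bigr\}.$$ Call $\sigma$ *calibrated* to $(\varepsilon,\delta)$ for size $n$ if $P\,e'(\alpha)+\frac{\log(1/\delta)}{\alpha-1}\le\varepsilon$ for some integer $\alpha\ge2$. **Proposition.** Let $1\le B\le n$, $\varepsilon>0$ and $0<\delta<1$. A calibrated $\sigma>0$ exists. For every calibrated $\sigma>0$, the output of DP-KIP with parameter $\sigma$ is a well-defined random distilled dataset (its law is a probability measure) on every target dataset of size at least $B$, and DP-KIP is $(\varepsilon,\delta)$-differentially private: the $(\varepsilon,\delta)$-inequality holds for all neighbouring datasets $\mathcal D,\mathcal D'$ of sizes at least $B$ of which at least one has size $n$.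 -/

import Mathlib

open MeasureTheory ProbabilityTheory
open scoped ENNReal

noncomputable section

namespace DPKIP

/-! ### Datasets, neighbouring datasets, differential privacy -/

/-- A labeled data point: an input in `ℝ^d` together with a scalar label. -/
abbrev Point (d : ℕ) : Type := EuclideanSpace ℝ (Fin d) × ℝ

/-- A finite dataset: its size `D.1` and its list of entries `D.2`. -/
abbrev Dataset (Z : Type) : Type := Σ n : ℕ, (Fin n → Z)

/-- Two datasets are neighbours if they differ in a single entry: one entry is replaced, or one
entry is inserted, or one entry is removed. -/
inductive Neighbors {Z : Type} : Dataset Z → Dataset Z → Prop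
  | replace {n : ℕ} (D : Fin n → Z) (i : Fin n) (z : Z) :
      Neighbors ⟨n, D⟩ ⟨n, Function.update D i z⟩
  | insert {n : ℕ} (D : Fin n → Z) (i : Fin (n + 1)) (z : Z) :
      Neighbors ⟨n, D⟩ ⟨n + 1, Fin.insertNth (α := fun _ => Z) i z D⟩
  | remove {n : ℕ} (D : Fin n → Z) (i : Fin (n + 1)) (z : Z) :
      Neighbors ⟨n + 1, Fin.insertNth (α := fun _ => Z) i z D⟩ ⟨n, D⟩

/-- `(ε, δ)`-differential privacy, with respect to the adjacency relation `adj`, of the randomized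
mechanism that outputs a sample of the law `M D` on the input `D`. -/
def IsDifferentiallyPrivate {𝒟 Ω : Type} [MeasurableSpace Ω] (M : 𝒟 → Measure Ω)
    (adj : 𝒟 → 𝒟 → Prop) (ε δ : ℝ) : Prop :=
  ∀ D D' : 𝒟, adj D D' → ∀ S : Set Ω, MeasurableSet S →
    M D S ≤ ENNReal.ofReal (Real.exp ε) * M D' S + ENNReal.ofReal δ

/-! ### The algorithm -/

/-- The data-independent inputs of the algorithm, for `m` distilled points in `ℝ^d` with labels in
`c` classes. The ridge parameter may depend on the distilled inputs, so that both a constant `lam`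
and the scale-invariant choice `lam * tr (K_ss) / m` are covered. -/
structure Config (d m c : ℕ) where
  /-- the kernel `k` -/
  kernel : EuclideanSpace ℝ (Fin d) → EuclideanSpace ℝ (Fin d) → ℝ
  /-- the ridge parameter -/
  ridge : EuclideanSpace ℝ (Fin m × Fin d) → ℝ
  /-- the scalar label of each class -/
  classLabel : Fin c → ℝ
  /-- the number `P` of iterations -/
  iterations : ℕ
  /-- the minibatch size `B` -/
  batch : ℕ
  /-- the clipping norm `C` -/
  clipNorm : ℝ
  /-- the SGD step size of each iteration -/
  stepSize : ℕ → ℝ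

/-- The `j`-th distilled input. All distilled inputs together form one vector of `ℝ^(m × d)`. -/
def row {d m : ℕ} (X : EuclideanSpace ℝ (Fin m × Fin d)) (j : Fin m) :
    EuclideanSpace ℝ (Fin d) :=
  WithLp.toLp 2 fun i => X (j, i)

namespace Config

variable {d m c : ℕ} (cfg : Config d m c)

/-- The kernel matrix `K_ss` of the distilled inputs. -/
def gram (X : EuclideanSpace ℝ (Fin m × Fin d)) : Matrix (Fin m) (Fin m) ℝ :=
  Matrix.of fun i j => cfg.kernel (row X i) (row X j)

/-- The kernel ridge regression prediction at `x`: `k_{xs} (K_ss + lam I)⁻¹ y_s`. -/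
def predict (X : EuclideanSpace ℝ (Fin m × Fin d)) (y : Fin m → ℝ)
    (x : EuclideanSpace ℝ (Fin d)) : ℝ :=
  (fun j => cfg.kernel x (row X j)) ⬝ᵥ
    ((cfg.gram X + cfg.ridge X • (1 : Matrix (Fin m) (Fin m) ℝ))⁻¹.mulVec y)

/-- The summand of the kernel ridge regression loss that belongs to the target point `z`. -/
def loss (y : Fin m → ℝ) (z : Point d) (X : EuclideanSpace ℝ (Fin m × Fin d)) : ℝ :=
  (z.2 - cfg.predict X y z.1) ^ 2

/-- The per-sample gradient of the loss with respect to the distilled inputs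
(by Mathlib's convention it is `0` where the loss is not differentiable). -/
def sampleGrad (y : Fin m → ℝ) (z : Point d) (X : EuclideanSpace ℝ (Fin m × Fin d)) :
    EuclideanSpace ℝ (Fin m × Fin d) :=
  gradient (cfg.loss y z) X

/-- The per-sample gradient, clipped to norm at most `C`: `g / max (1, ‖g‖ / C)`. -/
def clippedGrad (y : Fin m → ℝ) (z : Point d) (X : EuclideanSpace ℝ (Fin m × Fin d)) :
    EuclideanSpace ℝ (Fin m × Fin d) :=
  (max 1 (‖cfg.sampleGrad y z X‖ / cfg.clipNorm))⁻¹ • cfg.sampleGrad y z X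

theorem measurable_clippedGrad (y : Fin m → ℝ) (z : Point d) :
    Measurable (cfg.clippedGrad y z) := by
  have h : Measurable (cfg.sampleGrad y z) := by
    have h1 := measurable_fderiv ℝ (cfg.loss y z)
    exact (InnerProductSpace.toDual ℝ
      (EuclideanSpace ℝ (Fin m × Fin d))).symm.continuous.measurable.comp h1
  exact ((measurable_const.max (h.norm.div_const _)).inv).smul h

/-- The updated distilled inputs when the minibatch is `J` and the standard Gaussian noise takes
the value `ξ`: the noisy sum of the clipped gradients is averaged and an SGD step is made. -/
def update (σ : ℝ) (y : Fin m → ℝ) (D : Dataset (Point d)) (p : ℕ) (J : Finset (Fin D.1))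
    (X ξ : EuclideanSpace ℝ (Fin m × Fin d)) : EuclideanSpace ℝ (Fin m × Fin d) :=
  X - (cfg.stepSize p / cfg.batch) •
    (∑ l ∈ J, cfg.clippedGrad y (D.2 l) X + (σ * cfg.clipNorm) • ξ)

theorem measurable_update (σ : ℝ) (y : Fin m → ℝ) (D : Dataset (Point d)) (p : ℕ)
    (J : Finset (Fin D.1)) : Measurable (Function.uncurry (cfg.update σ y D p J)) := by
  have h : Measurable fun X => ∑ l ∈ J, cfg.clippedGrad y (D.2 l) X :=
    Finset.measurable_sum _ fun l _ => cfg.measurable_clippedGrad y (D.2 l)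
  have h' := ((h.comp measurable_fst).add
    ((measurable_snd (α := EuclideanSpace ℝ (Fin m × Fin d))).const_smul
      (σ * cfg.clipNorm))).const_smul (cfg.stepSize p / cfg.batch)
  exact measurable_fst.sub h'

/-- One iteration as a Markov kernel on the distilled inputs: a minibatch `J` is drawn uniformly
among the `B`-element subsets of the target dataset (sampling without replacement), independent
Gaussian noise is drawn, and the update is made. -/
def step (σ : ℝ) (y : Fin m → ℝ) (D : Dataset (Point d)) (p : ℕ) :
    Kernel (EuclideanSpace ℝ (Fin m × Fin d)) (EuclideanSpace ℝ (Fin m × Fin d)) where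
  toFun X := ∑ J ∈ Finset.powersetCard cfg.batch (Finset.univ : Finset (Fin D.1)),
    ((D.1.choose cfg.batch : ℝ≥0∞)⁻¹) •
      (stdGaussian (EuclideanSpace ℝ (Fin m × Fin d))).map (cfg.update σ y D p J X)
  measurable' := by
    refine Finset.measurable_sum _ fun J _ => ?_
    refine Measure.measurable_of_measurable_coe _ fun S hS => ?_
    have hu := cfg.measurable_update σ y D p J
    have h2 : ∀ X, ((((D.1.choose cfg.batch : ℝ≥0∞)⁻¹) •
        (stdGaussian (EuclideanSpace ℝ (Fin m × Fin d))).map (cfg.update σ y D p J X)) S)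
        = ((D.1.choose cfg.batch : ℝ≥0∞)⁻¹) * stdGaussian (EuclideanSpace ℝ (Fin m × Fin d))
          (Prod.mk X ⁻¹' (Function.uncurry (cfg.update σ y D p J) ⁻¹' S)) := by
      intro X
      have hm : Measurable (cfg.update σ y D p J X) := hu.comp measurable_prodMk_left
      rw [Measure.smul_apply, smul_eq_mul, Measure.map_apply hm hS]
      rfl
    simp_rw [h2]
    exact (measurable_measure_prodMk_left (hu hS)).const_mul _

/-- The law of the distilled inputs after `p` iterations, with distilled labels `y`. The initial
distilled inputs are independent standard Gaussian vectors. -/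
def inputsLaw (σ : ℝ) (y : Fin m → ℝ) (D : Dataset (Point d)) :
    ℕ → Measure (EuclideanSpace ℝ (Fin m × Fin d))
  | 0 => stdGaussian (EuclideanSpace ℝ (Fin m × Fin d))
  | p + 1 => (inputsLaw σ y D p).bind (cfg.step σ y D p)

/-- The law of the distilled dataset that the algorithm returns on the target dataset `D`, with
noise parameter `σ`. The classes `u` of the distilled points are drawn independently and uniformly,
and are kept fixed during the `P` iterations. -/
def outputLaw (σ : ℝ) (D : Dataset (Point d)) : Measure (Fin m → Point d) :=
  ∑ u : Fin m → Fin c, (((c : ℝ≥0∞) ^ m)⁻¹) •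
    (cfg.inputsLaw σ (cfg.classLabel ∘ u) D cfg.iterations).map
      (fun X j => (row X j, cfg.classLabel (u j)))

end Config

/-! ### The subsampled Rényi accountant -/

/-- The Rényi-DP curve `α ↦ α Δ² / (2 s²)` of the Gaussian mechanism which adds `N(0, s² I)` to a
query of global `ℓ²`-sensitivity `Δ`. -/
def gaussianRDP (Δ s : ℝ) (α : ℕ) : ℝ := α * Δ ^ 2 / (2 * s ^ 2)

/-- The bound on the Rényi-DP parameter, at the integer order `α ≥ 2`, of a mechanism with Rényi-DP
curve `e` that is applied to a uniformly random subsample without replacement, with sampling rate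
`γ`. This is the form of the bound for a mechanism which, as the Gaussian mechanism, satisfies no
pure differential privacy (`e ∞ = ∞`). Subsampling never hurts, hence the outer minimum. -/
def subsampledRDP (γ : ℝ) (e : ℕ → ℝ) (α : ℕ) : ℝ :=
  min (e α)
    (1 / ((α : ℝ) - 1) * Real.log (1
      + γ ^ 2 * (α.choose 2 : ℝ) * min (4 * (Real.exp (e 2) - 1)) (2 * Real.exp (e 2))
      + ∑ j ∈ Finset.Icc 3 α,
          γ ^ j * (α.choose j : ℝ) * (2 * Real.exp (((j : ℝ) - 1) * e j))))

/-- The accountant certifies `(ε, δ)` for `P` iterations at sampling rate `γ` of a mechanism with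
Rényi-DP curve `e`: the parameters add up over the iterations, and at some integer order `α ≥ 2`
the conversion from Rényi-DP with failure probability `δ` gives at most `ε`. -/
def AccountantCertifies (γ : ℝ) (e : ℕ → ℝ) (P : ℕ) (ε δ : ℝ) : Prop :=
  ∃ α : ℕ, 2 ≤ α ∧ P * subsampledRDP γ e α + Real.log (1 / δ) / ((α : ℝ) - 1) ≤ ε

/-- The noise parameter `σ` is calibrated to `(ε, δ)` for target datasets of size `n`. The accountant
is run with rate `B / n` on the Gaussian mechanism which adds `N(0, σ² C² I)` to a sum of `B`
vectors of norm at most `C`; exchanging one element of the minibatch changes such a sum by at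
most `2 C`. -/
def Config.Calibrated {d m c : ℕ} (cfg : Config d m c) (n : ℕ) (ε δ σ : ℝ) : Prop :=
  AccountantCertifies ((cfg.batch : ℝ) / n)
    (gaussianRDP (2 * cfg.clipNorm) (σ * cfg.clipNorm)) cfg.iterations ε δ

end DPKIP

end

/-!
Fix an integer order `α`. The Rényi divergence between the laws of the algorithm on two
neighbouring datasets is bounded for one iteration, the bounds are added up over the iterations,
and the sum is converted to `(ε, δ)`-differential privacy.

*One iteration.* Given the current distilled inputs, an iteration is a deterministic function of
`ξ + ∑ l ∈ J, v l`, where `ξ` is standard Gaussian, `J` is a random minibatch, and the vectors `v l`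
are the clipped gradients in units of the noise, which are pairwise at distance at most `2 / σ`
(`Config.step_eq_map`). Its law is a uniform mixture of translated Gaussians, with an explicit
density with respect to the standard Gaussian law (`map_add_stdGaussian`). Let `N + 1` be the size
of the larger dataset (under replacement, of either dataset), and `i` the entry in which the two
differ. On the event that `i` is not drawn, which has probability `1 - B / (N + 1)`, the larger
dataset yields the law `r` of a minibatch of the other `N` entries; otherwise it yields the law `p`
of `v i` plus a random sum of `B - 1` of the others (`subsampleMix_succ`). So the laws to be
compared are `(1 - γ) r + γ p` and `(1 - γ) r + γ q` with `γ = B / (N + 1)`, where `q` is the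
analogue of `p` under replacement; under insertion or removal one of `p` and `q` is `r` itself. The
laws `p`, `q`, `r` are pairwise coupled so that the centres of the Gaussians differ by the exchange
of one minibatch element; for `p` and `r` this is a double count of the pairs of a `(B - 1)`-set
and a further entry (`subsampleMix_eq_gaussianMix_pairs`). By joint convexity of
`x ^ j / y ^ (j - 1)`, their power divergences are at most those of two Gaussians (`momentBound_gaussianMix`).

*Amplification.* With `v = (1 - γ) r + γ q`, the moment `∫ ((1 - γ) r + γ p) ^ α / v ^ (α - 1)` is
expanded in powers of `γ (p - q) / v`. The linear term vanishes, and the term of order `j ≥ 2` is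
controlled by `∫ |p - q| ^ j / v ^ (j - 1)`, hence, by convexity in `v`, by the pairwise power
divergences (`momentBound_of_expansion`). The rate `γ` is at most `B / n`, since the larger dataset
has at least `n` entries.

*Composition and conversion.* A bound on the `L^α (ν)` norm of `dμ/dν` is equivalent to the Hölder
inequality `∫ f dμ ≤ K (∫ f ^ α' dν) ^ (1 / α')` for all `f ≥ 0`, with `α'` the conjugate exponent.
Taking this as the definition of a Rényi bound (`RenyiBound`) makes post-processing and adaptive
composition immediate, and for an indicator function it gives the `(ε, δ)`-inequality, by the
weighted inequality of arithmetic and geometric means (`RenyiBound.measure_le`).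
-/

open scoped RealInnerProductSpace

namespace DPKIP

/-! ### Translates of the standard Gaussian law -/

section Gaussian

variable {E : Type*} [NormedAddCommGroup E] [InnerProductSpace ℝ E] [FiniteDimensional ℝ E]
  [MeasurableSpace E] [BorelSpace E]

theorem integral_cexp_inner_stdGaussian (a t : E) :
    ∫ x, Complex.exp ((⟪a, x⟫ : ℝ) + (⟪x, t⟫ : ℝ) * Complex.I) ∂(stdGaussian E)
      = Complex.exp (((‖a‖ ^ 2 - ‖t‖ ^ 2) / 2 : ℝ) + (⟪a, t⟫ : ℝ) * Complex.I) := by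
  let b := stdOrthonormalBasis ℝ E
  let z : Fin (Module.finrank ℝ E) → ℂ := fun i => (⟪a, b i⟫ : ℝ) + (⟪b i, t⟫ : ℝ) * Complex.I
  rw [stdGaussian, integral_map (Measurable.aemeasurable (by fun_prop))
    (Measurable.aestronglyMeasurable (by fun_prop))]
  have h1 : ∀ x : Fin (Module.finrank ℝ E) → ℝ,
      Complex.exp ((⟪a, ∑ i, x i • b i⟫ : ℝ) + (⟪∑ i, x i • b i, t⟫ : ℝ) * Complex.I)
        = ∏ i, Complex.exp (z i * x i) := by
    intro x
    rw [← Complex.exp_sum]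
    congr 1
    simp only [z, inner_sum, sum_inner, real_inner_smul_left, real_inner_smul_right,
      Complex.ofReal_sum, Complex.ofReal_mul, Finset.sum_mul, ← Finset.sum_add_distrib]
    exact Finset.sum_congr rfl fun i _ => by ring
  have h2 : ∀ i, ∫ x : ℝ, Complex.exp (z i * x) ∂(gaussianReal 0 1)
      = Complex.exp (z i ^ 2 / 2) := by
    intro i
    have := complexMGF_id_gaussianReal (μ := 0) (v := 1) (z i)
    simpa [complexMGF] using this
  refine (integral_congr_ae (ae_of_all _ h1)).trans ?_
  rw [integral_fintype_prod_eq_prod (f := fun i (x : ℝ) => Complex.exp (z i * x))]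
  simp_rw [h2]
  rw [← Complex.exp_sum]
  congr 1
  have ha : ∑ i, ⟪a, b i⟫ ^ 2 = ‖a‖ ^ 2 := by
    simpa using b.sum_sq_inner_left a
  have ht : ∑ i, ⟪b i, t⟫ ^ 2 = ‖t‖ ^ 2 := by
    simpa using b.sum_sq_inner_right t
  have hat : ∑ i, ⟪a, b i⟫ * ⟪b i, t⟫ = ⟪a, t⟫ := b.sum_inner_mul_inner a t
  rw [← ha, ← ht, ← hat]
  push_cast
  rw [sub_div, Finset.sum_div, Finset.sum_div, ← Finset.sum_sub_distrib, Finset.sum_mul,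
    ← Finset.sum_add_distrib]
  refine Finset.sum_congr rfl fun i _ => ?_
  simp only [z]
  linear_combination ((⟪b i, t⟫ : ℝ) : ℂ) ^ 2 / 2 * Complex.I_sq

/-- The density of the standard Gaussian law translated by `a`, with respect to the standard
Gaussian law. -/
noncomputable def shiftDensity (a x : E) : ℝ := Real.exp (⟪a, x⟫ - ‖a‖ ^ 2 / 2)

omit [FiniteDimensional ℝ E] [MeasurableSpace E] [BorelSpace E] in
theorem continuous_shiftDensity (a : E) : Continuous (shiftDensity a) := by
  unfold shiftDensity; fun_prop

theorem integrable_exp_inner_stdGaussian (a : E) :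
    Integrable (fun x => Real.exp ⟪a, x⟫) (stdGaussian E) := by
  by_contra h
  have h0 : ∫ x, Real.exp ⟪a, x⟫ ∂(stdGaussian E) = 0 := integral_undef h
  have h1 := integral_cexp_inner_stdGaussian a 0
  simp only [inner_zero_right, Complex.ofReal_zero, zero_mul, add_zero, ← Complex.ofReal_exp] at h1
  rw [integral_complex_ofReal, h0] at h1
  exact (Real.exp_pos _).ne (by exact_mod_cast h1)

theorem integral_exp_inner_stdGaussian (a : E) :
    ∫ x, Real.exp ⟪a, x⟫ ∂(stdGaussian E) = Real.exp (‖a‖ ^ 2 / 2) := by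
  have h1 := integral_cexp_inner_stdGaussian a 0
  simp only [inner_zero_right, Complex.ofReal_zero, zero_mul, add_zero, ← Complex.ofReal_exp] at h1
  rw [integral_complex_ofReal] at h1
  have := Complex.ofReal_injective h1
  simpa using this

theorem integrable_shiftDensity (a : E) : Integrable (shiftDensity a) (stdGaussian E) := by
  unfold shiftDensity
  simp only [Real.exp_sub]
  exact (integrable_exp_inner_stdGaussian a).div_const _

theorem integral_shiftDensity (a : E) : ∫ x, shiftDensity a x ∂(stdGaussian E) = 1 := by
  simp_rw [shiftDensity, Real.exp_sub, integral_div, integral_exp_inner_stdGaussian]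
  exact div_self (Real.exp_pos _).ne'

/-- Both sides have the same characteristic function. -/
theorem map_add_stdGaussian (a : E) :
    (stdGaussian E).map (fun x => x + a)
      = (stdGaussian E).withDensity fun x => ENNReal.ofReal (shiftDensity a x) := by
  have : IsProbabilityMeasure ((stdGaussian E).map (fun x => x + a)) :=
    Measure.isProbabilityMeasure_map (by fun_prop)
  have : IsFiniteMeasure ((stdGaussian E).withDensity fun x => ENNReal.ofReal (shiftDensity a x)) :=
    isFiniteMeasure_withDensity_ofReal (integrable_shiftDensity a).2
  apply Measure.ext_of_charFun
  ext t
  rw [charFun_map_add_const, charFun_stdGaussian, charFun_apply,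
    integral_withDensity_eq_integral_toReal_smul
      (by have := (continuous_shiftDensity a).measurable; fun_prop) (by simp)]
  have h : ∀ x : E, (ENNReal.ofReal (shiftDensity a x)).toReal • Complex.exp (⟪x, t⟫ * Complex.I)
      = Complex.exp (-(‖a‖ ^ 2 / 2)) *
        Complex.exp ((⟪a, x⟫ : ℝ) + (⟪x, t⟫ : ℝ) * Complex.I) := by
    intro x
    rw [shiftDensity, ENNReal.toReal_ofReal (Real.exp_pos _).le, Complex.real_smul,
      Complex.ofReal_exp, ← Complex.exp_add, ← Complex.exp_add]
    congr 1
    push_cast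
    ring
  simp_rw [h]
  rw [integral_const_mul, integral_cexp_inner_stdGaussian, ← Complex.exp_add, ← Complex.exp_add]
  congr 1
  push_cast
  ring

omit [FiniteDimensional ℝ E] [MeasurableSpace E] [BorelSpace E] in
/-- The power divergences between two translates of the standard Gaussian law. -/
theorem shiftDensity_pow_div_pow (a b x : E) {j : ℕ} (hj : 1 ≤ j) :
    shiftDensity a x ^ j / shiftDensity b x ^ (j - 1)
      = Real.exp ((j : ℝ) * (j - 1) * ‖a - b‖ ^ 2 / 2)
        * shiftDensity ((j : ℝ) • a - ((j : ℝ) - 1) • b) x := by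
  simp only [shiftDensity, ← Real.exp_nat_mul, ← Real.exp_sub, ← Real.exp_add]
  congr 1
  rw [norm_sub_sq_real, norm_sub_sq_real, Nat.cast_sub hj, inner_sub_left, real_inner_smul_left,
    real_inner_smul_left, real_inner_smul_left, real_inner_smul_right, norm_smul, norm_smul,
    mul_pow, mul_pow, Real.norm_eq_abs, Real.norm_eq_abs, sq_abs, sq_abs]
  push_cast
  ring

end Gaussian

/-! ### Power divergences and privacy amplification by subsampling -/

/-- The map `(x, y) ↦ x ^ j / y ^ (j - 1)` is jointly convex (it is a perspective function). -/
theorem sum_pow_div_sum_pow_le {ι : Type*} (s : Finset ι) (w x y : ι → ℝ)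
    (hw : ∀ i ∈ s, 0 ≤ w i) (hx : ∀ i ∈ s, 0 ≤ x i) (hy : ∀ i ∈ s, 0 < y i) {j : ℕ} (hj : 1 ≤ j) :
    (∑ i ∈ s, w i * x i) ^ j / (∑ i ∈ s, w i * y i) ^ (j - 1)
      ≤ ∑ i ∈ s, w i * (x i ^ j / y i ^ (j - 1)) := by
  obtain ⟨k, rfl⟩ : ∃ k, j = k + 1 := ⟨j - 1, by omega⟩
  simp only [Nat.add_sub_cancel]
  set Q := ∑ i ∈ s, w i * y i with hQdef
  have hwy : ∀ i ∈ s, 0 ≤ w i * y i := fun i hi => mul_nonneg (hw i hi) (hy i hi).le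
  have hR : 0 ≤ ∑ i ∈ s, w i * (x i ^ (k + 1) / y i ^ k) :=
    Finset.sum_nonneg fun i hi =>
      mul_nonneg (hw i hi) (div_nonneg (pow_nonneg (hx i hi) _) (pow_nonneg (hy i hi).le _))
  rcases (Finset.sum_nonneg hwy).eq_or_lt with h0 | hQ
  · have hz := (Finset.sum_eq_zero_iff_of_nonneg hwy).1 h0.symm
    have hsum : ∑ i ∈ s, w i * x i = 0 := Finset.sum_eq_zero fun i hi => by
      rcases mul_eq_zero.1 (hz i hi) with h | h
      · simp [h]
      · exact absurd h (hy i hi).ne'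
    rw [hsum]
    simpa using hR
  · rw [← hQdef] at hQ
    -- Jensen's inequality for the weights `w i * y i / Q` and the ratios `x i / y i`
    have hJ := Real.pow_arith_mean_le_arith_mean_pow s (fun i => w i * y i / Q)
      (fun i => x i / y i) (fun i hi => div_nonneg (hwy i hi) hQ.le)
      (by rw [← Finset.sum_div, ← hQdef, div_self hQ.ne'])
      (fun i hi => div_nonneg (hx i hi) (hy i hi).le) (k + 1)
    have e1 : ∑ i ∈ s, w i * y i / Q * (x i / y i) = (∑ i ∈ s, w i * x i) / Q := by
      rw [Finset.sum_div]
      exact Finset.sum_congr rfl fun i hi => by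
        have := (hy i hi).ne'
        field_simp
    have e2 : ∑ i ∈ s, w i * y i / Q * (x i / y i) ^ (k + 1)
        = (∑ i ∈ s, w i * (x i ^ (k + 1) / y i ^ k)) / Q := by
      rw [Finset.sum_div]
      exact Finset.sum_congr rfl fun i hi => by
        have := (hy i hi).ne'
        rw [div_pow, pow_succ (y i)]
        field_simp
    rw [e1, e2, div_pow, le_div_iff₀ hQ] at hJ
    calc (∑ i ∈ s, w i * x i) ^ (k + 1) / Q ^ k
        = (∑ i ∈ s, w i * x i) ^ (k + 1) / Q ^ (k + 1) * Q := by
          rw [pow_succ Q]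
          field_simp
      _ ≤ _ := hJ

/-- The two-point case of the joint convexity of `(x, y) ↦ x ^ j / y ^ (j - 1)`. -/
theorem add_pow_div_add_pow_le {a b x₁ x₂ y₁ y₂ : ℝ} (ha : 0 ≤ a) (hb : 0 ≤ b) (hx₁ : 0 ≤ x₁)
    (hx₂ : 0 ≤ x₂) (hy₁ : 0 < y₁) (hy₂ : 0 < y₂) {j : ℕ} (hj : 1 ≤ j) :
    (a * x₁ + b * x₂) ^ j / (a * y₁ + b * y₂) ^ (j - 1)
      ≤ a * (x₁ ^ j / y₁ ^ (j - 1)) + b * (x₂ ^ j / y₂ ^ (j - 1)) := by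
  have h := sum_pow_div_sum_pow_le Finset.univ ![a, b] ![x₁, x₂] ![y₁, y₂]
    (by simp [Fin.forall_fin_two, ha, hb]) (by simp [Fin.forall_fin_two, hx₁, hx₂])
    (by simp [Fin.forall_fin_two, hy₁, hy₂]) hj
  simpa using h

section Moment

variable {Ω : Type*} [MeasurableSpace Ω] {β : Measure Ω}

/-- A positive probability density with respect to `β`. -/
structure IsDensity (β : Measure Ω) (p : Ω → ℝ) : Prop where
  measurable : Measurable p
  pos : ∀ x, 0 < p x
  integrable : Integrable p β
  integral_eq_one : ∫ x, p x ∂β = 1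

/-- The power divergence of order `j` between the laws with `β`-densities `p` and `q`, that is the
`j`-th moment `∫ p ^ j / q ^ (j - 1) ∂β` of the likelihood ratio, is finite and at most `M`. -/
def MomentBound (β : Measure Ω) (p q : Ω → ℝ) (j : ℕ) (M : ℝ) : Prop :=
  Integrable (fun x => p x ^ j / q x ^ (j - 1)) β ∧ ∫ x, p x ^ j / q x ^ (j - 1) ∂β ≤ M

theorem MomentBound.of_le {p q F : Ω → ℝ} {j : ℕ} {M : ℝ} (hp : Measurable p)
    (hq : Measurable q) (hp0 : ∀ x, 0 ≤ p x) (hq0 : ∀ x, 0 ≤ q x) (hF : Integrable F β)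
    (hFM : ∫ x, F x ∂β ≤ M) (h : ∀ x, p x ^ j / q x ^ (j - 1) ≤ F x) : MomentBound β p q j M := by
  have hi : Integrable (fun x => p x ^ j / q x ^ (j - 1)) β := by
    refine hF.mono' ((hp.pow_const j).div (hq.pow_const _)).aestronglyMeasurable
      (ae_of_all _ fun x => ?_)
    rw [Real.norm_of_nonneg (div_nonneg (pow_nonneg (hp0 x) _) (pow_nonneg (hq0 x) _))]
    exact h x
  exact ⟨hi, (integral_mono hi hF h).trans hFM⟩

theorem MomentBound.mono {p q : Ω → ℝ} {j : ℕ} {M M' : ℝ} (h : MomentBound β p q j M)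
    (hM : M ≤ M') : MomentBound β p q j M' := ⟨h.1, h.2.trans hM⟩

theorem IsDensity.momentBound_self {p : Ω → ℝ} (hp : IsDensity β p) {j : ℕ} (hj : 1 ≤ j) :
    MomentBound β p p j 1 := by
  have h : (fun x => p x ^ j / p x ^ (j - 1)) = p := by
    ext x
    obtain ⟨k, rfl⟩ : ∃ k, j = k + 1 := ⟨j - 1, by omega⟩
    have := (hp.pos x).ne'
    simp only [Nat.add_sub_cancel]
    rw [pow_succ]
    field_simp
  unfold MomentBound
  rw [h]
  exact ⟨hp.integrable, hp.integral_eq_one.le⟩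

theorem IsDensity.mix {p q : Ω → ℝ} (hp : IsDensity β p) (hq : IsDensity β q) {γ : ℝ} (h0 : 0 ≤ γ)
    (h1 : γ ≤ 1) : IsDensity β fun x => (1 - γ) * p x + γ * q x where
  measurable := (hp.measurable.const_mul _).add (hq.measurable.const_mul _)
  pos x := by
    have hp' := hp.pos x
    have hq' := hq.pos x
    rcases h0.eq_or_lt with rfl | h
    · simpa using hp'
    · exact add_pos_of_nonneg_of_pos (mul_nonneg (by linarith) hp'.le) (mul_pos h hq')
  integrable := (hp.integrable.const_mul _).add (hq.integrable.const_mul _)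
  integral_eq_one := by
    rw [integral_add (hp.integrable.const_mul _) (hq.integrable.const_mul _), integral_const_mul,
      integral_const_mul, hp.integral_eq_one, hq.integral_eq_one]
    ring

/-- Joint convexity of the power divergence, for two mixtures with the same weights. -/
theorem MomentBound.mix {p₁ p₂ q₁ q₂ : Ω → ℝ} {j : ℕ} {M γ : ℝ} (hj : 1 ≤ j) (h0 : 0 ≤ γ)
    (h1 : γ ≤ 1) (hp₁m : Measurable p₁) (hp₂m : Measurable p₂) (hp₁ : ∀ x, 0 ≤ p₁ x)
    (hp₂ : ∀ x, 0 ≤ p₂ x) (hq₁ : IsDensity β q₁) (hq₂ : IsDensity β q₂)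
    (H₁ : MomentBound β p₁ q₁ j M) (H₂ : MomentBound β p₂ q₂ j M) :
    MomentBound β (fun x => (1 - γ) * p₁ x + γ * p₂ x) (fun x => (1 - γ) * q₁ x + γ * q₂ x)
      j M := by
  have hγ : 0 ≤ 1 - γ := by linarith
  refine MomentBound.of_le
    (F := fun x => (1 - γ) * (p₁ x ^ j / q₁ x ^ (j - 1)) + γ * (p₂ x ^ j / q₂ x ^ (j - 1)))
    ((hp₁m.const_mul _).add (hp₂m.const_mul _)) (hq₁.mix hq₂ h0 h1).measurable
    (fun x => add_nonneg (mul_nonneg hγ (hp₁ x)) (mul_nonneg h0 (hp₂ x)))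
    (fun x => ((hq₁.mix hq₂ h0 h1).pos x).le)
    ((H₁.1.const_mul _).add (H₂.1.const_mul _)) ?_
    fun x => add_pow_div_add_pow_le hγ h0 (hp₁ x) (hp₂ x) (hq₁.pos x) (hq₂.pos x) hj
  rw [integral_add (H₁.1.const_mul _) (H₂.1.const_mul _), integral_const_mul, integral_const_mul]
  nlinarith [mul_le_mul_of_nonneg_left H₁.2 hγ, mul_le_mul_of_nonneg_left H₂.2 h0]

theorem abs_sub_pow_le_pow_add_pow {a b : ℝ} (ha : 0 ≤ a) (hb : 0 ≤ b) (j : ℕ) :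
    |a - b| ^ j ≤ a ^ j + b ^ j := by
  rcases le_total a b with h | h
  · rw [abs_sub_comm, abs_of_nonneg (by linarith)]
    have := pow_le_pow_left₀ (by linarith : 0 ≤ b - a) (by linarith : b - a ≤ b) j
    have := pow_nonneg ha j
    linarith
  · rw [abs_of_nonneg (by linarith)]
    have := pow_le_pow_left₀ (by linarith : 0 ≤ a - b) (by linarith : a - b ≤ a) j
    have := pow_nonneg hb j
    linarith

/-- The ternary divergence `∫ |p - q| ^ j / r ^ (j - 1)` is at most the sum of the power divergences
of `p` and of `q` from `r`. -/
theorem MomentBound.abs_sub {p q r : Ω → ℝ} {j : ℕ} {M₁ M₂ : ℝ} (hp : IsDensity β p)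
    (hq : IsDensity β q) (hr : IsDensity β r) (H₁ : MomentBound β p r j M₁)
    (H₂ : MomentBound β q r j M₂) : MomentBound β (fun x => |p x - q x|) r j (M₁ + M₂) := by
  refine MomentBound.of_le (F := fun x => p x ^ j / r x ^ (j - 1) + q x ^ j / r x ^ (j - 1))
    (hp.measurable.sub hq.measurable).abs hr.measurable (fun x => abs_nonneg _)
    (fun x => (hr.pos x).le) (H₁.1.add H₂.1) ?_ fun x => ?_
  · rw [integral_add H₁.1 H₂.1]
    exact add_le_add H₁.2 H₂.2
  · rw [← add_div]
    exact div_le_div_of_nonneg_right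
      (abs_sub_pow_le_pow_add_pow (hp.pos x).le (hq.pos x).le j) (pow_nonneg (hr.pos x).le _)

/-- The quadratic ternary divergence is controlled by the two `χ²`-divergences from `r`. -/
theorem MomentBound.abs_sub_two {p q r : Ω → ℝ} {M₁ M₂ : ℝ} (hp : IsDensity β p)
    (hq : IsDensity β q) (hr : IsDensity β r) (H₁ : MomentBound β p r 2 M₁)
    (H₂ : MomentBound β q r 2 M₂) :
    MomentBound β (fun x => |p x - q x|) r 2 (2 * (M₁ - 1) + 2 * (M₂ - 1)) := by
  have i1 : Integrable (fun x => p x ^ 2 / r x ^ (2 - 1) - 2 * p x + r x) β :=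
    (H₁.1.sub (hp.integrable.const_mul 2)).add hr.integrable
  have i2 : Integrable (fun x => q x ^ 2 / r x ^ (2 - 1) - 2 * q x + r x) β :=
    (H₂.1.sub (hq.integrable.const_mul 2)).add hr.integrable
  refine MomentBound.of_le (F := fun x => 2 * (p x ^ 2 / r x ^ (2 - 1) - 2 * p x + r x)
      + 2 * (q x ^ 2 / r x ^ (2 - 1) - 2 * q x + r x))
    (hp.measurable.sub hq.measurable).abs hr.measurable (fun x => abs_nonneg _)
    (fun x => (hr.pos x).le) ((i1.const_mul 2).add (i2.const_mul 2)) ?_ fun x => ?_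
  · rw [integral_add (i1.const_mul 2) (i2.const_mul 2), integral_const_mul, integral_const_mul]
    have e1 : ∫ x, (p x ^ 2 / r x ^ (2 - 1) - 2 * p x + r x) ∂β
        = ∫ x, p x ^ 2 / r x ^ (2 - 1) ∂β - 2 * 1 + 1 := by
      rw [integral_add (f := fun x => p x ^ 2 / r x ^ (2 - 1) - 2 * p x)
          (H₁.1.sub (hp.integrable.const_mul 2)) hr.integrable,
        integral_sub H₁.1 (hp.integrable.const_mul 2), integral_const_mul, hp.integral_eq_one,
        hr.integral_eq_one]
    have e2 : ∫ x, (q x ^ 2 / r x ^ (2 - 1) - 2 * q x + r x) ∂β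
        = ∫ x, q x ^ 2 / r x ^ (2 - 1) ∂β - 2 * 1 + 1 := by
      rw [integral_add (f := fun x => q x ^ 2 / r x ^ (2 - 1) - 2 * q x)
          (H₂.1.sub (hq.integrable.const_mul 2)) hr.integrable,
        integral_sub H₂.1 (hq.integrable.const_mul 2), integral_const_mul, hq.integral_eq_one,
        hr.integral_eq_one]
    have h1 := H₁.2
    have h2 := H₂.2
    rw [e1, e2]
    linarith
  · have hr0 := hr.pos x
    simp only [sq_abs, Nat.add_one_sub_one, pow_one]
    rw [div_le_iff₀ hr0]
    have : (2 * (p x ^ 2 / r x - 2 * p x + r x) + 2 * (q x ^ 2 / r x - 2 * q x + r x)) * r x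
        = 2 * (p x - r x) ^ 2 + 2 * (q x - r x) ^ 2 := by
      field_simp
      ring
    rw [this]
    nlinarith [sq_nonneg (p x - r x + (q x - r x))]

/-- Privacy amplification by subsampling: the two laws share the component `r` and differ only in a
component of weight `γ`. The power `(1 + γ (p - q) / v) ^ α` of the likelihood ratio is expanded by
the binomial theorem; its linear term integrates to zero. -/
theorem momentBound_of_expansion {p q r : Ω → ℝ} {e : ℕ → ℝ} {γ γ' : ℝ} (he : ∀ j, 0 ≤ e j)
    (hp : IsDensity β p) (hq : IsDensity β q) (hr : IsDensity β r)
    (hpr : ∀ j, 2 ≤ j → MomentBound β p r j (Real.exp (((j : ℝ) - 1) * e j)))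
    (hqr : ∀ j, 2 ≤ j → MomentBound β q r j (Real.exp (((j : ℝ) - 1) * e j)))
    (hpq : ∀ j, 2 ≤ j → MomentBound β p q j (Real.exp (((j : ℝ) - 1) * e j)))
    (h0 : 0 ≤ γ) (h1 : γ ≤ 1) (hγ : γ ≤ γ') {α : ℕ} (hα : 2 ≤ α) :
    MomentBound β (fun x => (1 - γ) * r x + γ * p x) (fun x => (1 - γ) * r x + γ * q x) α
      (1 + γ' ^ 2 * (α.choose 2 : ℝ) * min (4 * (Real.exp (e 2) - 1)) (2 * Real.exp (e 2))
      + ∑ j ∈ Finset.Icc 3 α,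
          γ' ^ j * (α.choose j : ℝ) * (2 * Real.exp (((j : ℝ) - 1) * e j))) := by
  have hu := hr.mix hp h0 h1
  have hv := hr.mix hq h0 h1
  set u : Ω → ℝ := fun x => (1 - γ) * r x + γ * p x with hudef
  set v : Ω → ℝ := fun x => (1 - γ) * r x + γ * q x with hvdef
  have hexp1 : ∀ j : ℕ, 2 ≤ j → 1 ≤ Real.exp (((j : ℝ) - 1) * e j) := fun j hj =>
    Real.one_le_exp (mul_nonneg (by
      have : (2 : ℝ) ≤ j := by exact_mod_cast hj
      linarith) (he j))
  have habs : ∀ x, (1 - γ) * |p x - q x| + γ * |p x - q x| = |p x - q x| := fun x => by ring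
  have hm := (hp.measurable.sub hq.measurable).abs
  -- the ternary divergences of `p`, `q` from the mixture `v`
  have hT : ∀ j, 2 ≤ j →
      MomentBound β (fun x => |p x - q x|) v j (2 * Real.exp (((j : ℝ) - 1) * e j)) := by
    intro j hj
    have hA := (MomentBound.abs_sub hp hq hr (hpr j hj) (hqr j hj)).mono (by linarith :
      _ ≤ 2 * Real.exp (((j : ℝ) - 1) * e j))
    have hB := (MomentBound.abs_sub hp hq hq (hpq j hj)
      (hq.momentBound_self (by omega))).mono (by linarith [hexp1 j hj] :
      _ ≤ 2 * Real.exp (((j : ℝ) - 1) * e j))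
    have := MomentBound.mix (by omega) h0 h1 hm hm (fun x => abs_nonneg _)
      (fun x => abs_nonneg _) hr hq hA hB
    simpa only [Pi.sub_apply, habs] using this
  have hT2 : MomentBound β (fun x => |p x - q x|) v 2
      (min (4 * (Real.exp (e 2) - 1)) (2 * Real.exp (e 2))) := by
    have he2 : (((2 : ℕ) : ℝ) - 1) * e 2 = e 2 := by push_cast; ring
    have h1pr := hpr 2 le_rfl
    have h1qr := hqr 2 le_rfl
    have h1pq := hpq 2 le_rfl
    have hT' := hT 2 le_rfl
    have hx := hexp1 2 le_rfl
    rw [he2] at h1pr h1qr h1pq hT' hx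
    have hA := (MomentBound.abs_sub_two hp hq hr h1pr h1qr).mono (by linarith :
      _ ≤ 4 * (Real.exp (e 2) - 1))
    have hB := (MomentBound.abs_sub_two hp hq hq h1pq
      (hq.momentBound_self (by omega))).mono (by linarith :
      _ ≤ 4 * (Real.exp (e 2) - 1))
    have := MomentBound.mix (by omega) h0 h1 hm hm (fun x => abs_nonneg _)
      (fun x => abs_nonneg _) hr hq hA hB
    simp only [Pi.sub_apply, habs] at this
    exact ⟨this.1, le_min this.2 hT'.2⟩
  let T : ℕ → Ω → ℝ := fun j x => |p x - q x| ^ j / v x ^ (j - 1)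
  have hTi : ∀ j ∈ Finset.Icc 2 α, Integrable (fun x => γ ^ j * (α.choose j : ℝ) * T j x) β :=
    fun j hj => (hT j (Finset.mem_Icc.1 hj).1).1.const_mul _
  have hsub : Integrable (fun x => α * γ * (p x - q x)) β :=
    (hp.integrable.sub hq.integrable).const_mul _
  have hlin : Integrable (fun x => v x + α * γ * (p x - q x)) β :=
    hv.integrable.add hsub
  refine MomentBound.of_le (F := fun x => (v x + α * γ * (p x - q x))
      + ∑ j ∈ Finset.Icc 2 α, γ ^ j * (α.choose j : ℝ) * T j x)
    hu.measurable hv.measurable (fun x => (hu.pos x).le) (fun x => (hv.pos x).le)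
    (hlin.add (integrable_finsetSum _ hTi)) ?_ fun x => ?_
  · rw [integral_add hlin (integrable_finsetSum _ hTi), integral_finsetSum _ hTi,
      integral_add hv.integrable hsub,
      integral_const_mul, integral_sub hp.integrable hq.integrable, hp.integral_eq_one,
      hq.integral_eq_one, hv.integral_eq_one, sub_self, mul_zero, add_zero,
      ← Finset.add_sum_Ioc_eq_sum_Icc hα, ← add_assoc]
    have hmin0 : 0 ≤ min (4 * (Real.exp (e 2) - 1)) (2 * Real.exp (e 2)) :=
      le_min (by linarith [Real.one_le_exp (he 2)]) (by positivity)
    refine add_le_add (add_le_add le_rfl ?_) ?_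
    · rw [integral_const_mul]
      exact mul_le_mul (mul_le_mul_of_nonneg_right (pow_le_pow_left₀ h0 hγ 2) (by positivity))
        hT2.2 (integral_nonneg fun x => div_nonneg (by positivity) (pow_nonneg (hv.pos x).le _))
        (by positivity)
    · refine Finset.sum_le_sum fun j hj => ?_
      have hj3 := (Finset.mem_Icc.1 hj).1
      rw [integral_const_mul]
      exact mul_le_mul (mul_le_mul_of_nonneg_right (pow_le_pow_left₀ h0 hγ j) (by positivity))
        (hT j (by omega)).2
        (integral_nonneg fun x => div_nonneg (by positivity) (pow_nonneg (hv.pos x).le _))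
        (mul_nonneg (pow_nonneg (h0.trans hγ) _) (by positivity))
  · have hv0 := hv.pos x
    have hu' : u x = γ * (p x - q x) + v x := by simp only [hudef, hvdef]; ring
    have hterm : ∀ j ∈ Finset.range (α + 1),
        (γ * (p x - q x)) ^ j * v x ^ (α - j) * (α.choose j : ℝ) / v x ^ (α - 1)
          ≤ if j = 0 then v x else if j = 1 then α * γ * (p x - q x)
            else γ ^ j * (α.choose j : ℝ) * T j x := by
      intro j hj
      have hjα : j ≤ α := by simpa [Nat.lt_succ_iff] using hj
      have hvne := hv0.ne'
      rcases Nat.eq_zero_or_pos j with rfl | hjpos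
      · obtain ⟨k, rfl⟩ : ∃ k, α = k + 1 := ⟨α - 1, by omega⟩
        simp only [pow_zero, Nat.sub_zero, one_mul, Nat.choose_zero_right, Nat.cast_one, mul_one,
          Nat.add_sub_cancel, if_true]
        rw [pow_succ]
        field_simp
        exact le_rfl
      · rw [if_neg hjpos.ne']
        have hsplit : v x ^ (α - 1) = v x ^ (α - j) * v x ^ (j - 1) := by
          rw [← pow_add]; congr 1; omega
        have hre : (γ * (p x - q x)) ^ j * v x ^ (α - j) * (α.choose j : ℝ) / v x ^ (α - 1)
            = γ ^ j * (α.choose j : ℝ) * ((p x - q x) ^ j / v x ^ (j - 1)) := by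
          rw [hsplit, mul_pow]
          field_simp
        rw [hre]
        by_cases hj1 : j = 1
        · subst hj1
          simp only [if_true, pow_one, Nat.choose_one_right, Nat.sub_self, pow_zero, div_one]
          exact le_of_eq (by ring)
        · rw [if_neg hj1]
          refine mul_le_mul_of_nonneg_left ?_ (by positivity)
          refine div_le_div_of_nonneg_right ?_ (by positivity)
          rw [← abs_pow]
          exact le_abs_self _
    rw [hu', add_pow, Finset.sum_div]
    refine (Finset.sum_le_sum hterm).trans (le_of_eq ?_)
    rw [Finset.range_eq_Ico, Finset.sum_eq_sum_Ico_succ_bot (by omega),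
      Finset.sum_eq_sum_Ico_succ_bot (by omega), ← add_assoc]
    simp only [if_true, zero_add, one_ne_zero, if_false]
    congr 1
    have : Finset.Ico (1 + 1) (α + 1) = Finset.Icc 2 α := by ext j; simp
    rw [this]
    refine Finset.sum_congr rfl fun j hj => ?_
    have := (Finset.mem_Icc.1 hj).1
    rw [if_neg (by omega), if_neg (by omega)]

/-- The subsampled Rényi accountant bounds the power divergence between two mixtures that differ
only in a component of weight `γ`. -/
theorem momentBound_subsampledRDP {p q r : Ω → ℝ} {e : ℕ → ℝ} {γ γ' : ℝ} (he : ∀ j, 0 ≤ e j)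
    (hp : IsDensity β p) (hq : IsDensity β q) (hr : IsDensity β r)
    (hpr : ∀ j, 2 ≤ j → MomentBound β p r j (Real.exp (((j : ℝ) - 1) * e j)))
    (hqr : ∀ j, 2 ≤ j → MomentBound β q r j (Real.exp (((j : ℝ) - 1) * e j)))
    (hpq : ∀ j, 2 ≤ j → MomentBound β p q j (Real.exp (((j : ℝ) - 1) * e j)))
    (h0 : 0 ≤ γ) (h1 : γ ≤ 1) (hγ : γ ≤ γ') {α : ℕ} (hα : 2 ≤ α) :
    MomentBound β (fun x => (1 - γ) * r x + γ * p x) (fun x => (1 - γ) * r x + γ * q x) α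
      (Real.exp (((α : ℝ) - 1) * subsampledRDP γ' e α)) := by
  have hα' : (0 : ℝ) < (α : ℝ) - 1 := by
    have : (2 : ℝ) ≤ α := by exact_mod_cast hα
    linarith
  have hγ' := h0.trans hγ
  have hmin0 : 0 ≤ min (4 * (Real.exp (e 2) - 1)) (2 * Real.exp (e 2)) :=
    le_min (by linarith [Real.one_le_exp (he 2)]) (by positivity)
  unfold subsampledRDP
  rcases min_choice (e α) (1 / ((α : ℝ) - 1) * Real.log (1
      + γ' ^ 2 * (α.choose 2 : ℝ) * min (4 * (Real.exp (e 2) - 1)) (2 * Real.exp (e 2))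
      + ∑ j ∈ Finset.Icc 3 α,
          γ' ^ j * (α.choose j : ℝ) * (2 * Real.exp (((j : ℝ) - 1) * e j)))) with h | h
  · rw [h]
    refine MomentBound.mix (by omega) h0 h1 hr.measurable hp.measurable (fun x => (hr.pos x).le)
      (fun x => (hp.pos x).le) hr hq ((hr.momentBound_self (by omega)).mono ?_) (hpq α hα)
    exact Real.one_le_exp (mul_nonneg hα'.le (he α))
  · rw [h, ← mul_assoc, mul_one_div_cancel hα'.ne', one_mul, Real.exp_log (by positivity)]
    exact momentBound_of_expansion he hp hq hr hpr hqr hpq h0 h1 hγ hα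

end Moment

/-! ### Rényi divergence bounds: post-processing, composition and conversion -/

section Renyi

variable {Ω Ω' : Type*} [MeasurableSpace Ω] [MeasurableSpace Ω']

/-- The Rényi divergence of order `α > 1` of `μ` from `ν` is at most `ρ`. This is stated through the
dual (Hölder) characterization of the `L^α (ν)` norm of the density `dμ/dν`, which is at most
`exp (ρ (1 - 1/α))`; it refers to no density, and so passes to images and to mixtures. -/
def RenyiBound (α ρ : ℝ) (μ ν : Measure Ω) : Prop :=
  ∀ f : Ω → ℝ≥0∞, Measurable f →
    ∫⁻ x, f x ∂μ ≤ ENNReal.ofReal (Real.exp (ρ * (1 - 1 / α)))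
      * (∫⁻ x, f x ^ (α / (α - 1)) ∂ν) ^ (1 - 1 / α)

theorem RenyiBound.refl {α : ℝ} (hα : 1 < α) (μ : Measure Ω) [IsProbabilityMeasure μ] :
    RenyiBound α 0 μ μ := by
  intro f hf
  have hconj : (α / (α - 1)).HolderConjugate α :=
    (Real.HolderConjugate.conjExponent hα).symm
  have h := ENNReal.lintegral_mul_le_Lp_mul_Lq μ hconj hf.aemeasurable
    (measurable_const (a := (1 : ℝ≥0∞))).aemeasurable
  have h1 : 1 / (α / (α - 1)) = 1 - 1 / α := by
    have := hconj.inv_add_inv_eq_one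
    simp only [one_div]
    linarith
  simpa [h1] using h

theorem RenyiBound.map {α ρ : ℝ} {μ ν : Measure Ω} (h : RenyiBound α ρ μ ν) {g : Ω → Ω'}
    (hg : Measurable g) : RenyiBound α ρ (μ.map g) (ν.map g) := by
  intro f hf
  rw [lintegral_map hf hg, lintegral_map (hf.pow_const _) hg]
  exact h _ (hf.comp hg)

/-- Adaptive composition: the bounds for the two stages add up. -/
theorem RenyiBound.bind {α ρ₁ ρ₂ : ℝ} (hα : 1 < α) {μ ν : Measure Ω} {κ η : Kernel Ω Ω'}
    (h : RenyiBound α ρ₁ μ ν) (hκ : ∀ x, RenyiBound α ρ₂ (κ x) (η x)) :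
    RenyiBound α (ρ₁ + ρ₂) (μ.bind κ) (ν.bind η) := by
  intro f hf
  have hα0 : 0 < α := by linarith
  have hs : 0 < 1 - 1 / α := by
    rw [sub_pos, div_lt_one hα0]
    exact hα
  rw [Measure.lintegral_bind κ.aemeasurable hf.aemeasurable,
    Measure.lintegral_bind η.aemeasurable (hf.pow_const _).aemeasurable]
  set A : Ω → ℝ≥0∞ := fun x => ∫⁻ y, f y ^ (α / (α - 1)) ∂(η x)
  have hA : Measurable A := (hf.pow_const _).lintegral_kernel
  have hpow : ∀ x, (A x ^ (1 - 1 / α)) ^ (α / (α - 1)) = A x := by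
    intro x
    rw [← ENNReal.rpow_mul]
    have : (1 - 1 / α) * (α / (α - 1)) = 1 := by
      have : α - 1 ≠ 0 := by linarith
      field_simp
    rw [this, ENNReal.rpow_one]
  calc ∫⁻ x, ∫⁻ y, f y ∂(κ x) ∂μ
      ≤ ∫⁻ x, ENNReal.ofReal (Real.exp (ρ₂ * (1 - 1 / α))) * A x ^ (1 - 1 / α) ∂μ :=
        lintegral_mono fun x => hκ x f hf
    _ = ENNReal.ofReal (Real.exp (ρ₂ * (1 - 1 / α))) * ∫⁻ x, A x ^ (1 - 1 / α) ∂μ :=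
        lintegral_const_mul _ (hA.pow_const _)
    _ ≤ ENNReal.ofReal (Real.exp (ρ₂ * (1 - 1 / α)))
          * (ENNReal.ofReal (Real.exp (ρ₁ * (1 - 1 / α)))
            * (∫⁻ x, (A x ^ (1 - 1 / α)) ^ (α / (α - 1)) ∂ν) ^ (1 - 1 / α)) := by
        gcongr
        exact h _ (hA.pow_const _)
    _ = _ := by
        simp_rw [hpow]
        rw [← mul_assoc, ← ENNReal.ofReal_mul (Real.exp_pos _).le, ← Real.exp_add]
        congr 3
        ring

/-- Conversion to approximate differential privacy. -/
theorem RenyiBound.measure_le {α ρ ε δ : ℝ} (hα : 1 < α) (hδ : 0 < δ) {μ ν : Measure Ω}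
    [IsFiniteMeasure ν] (h : RenyiBound α ρ μ ν) (hε : ρ + Real.log (1 / δ) / (α - 1) ≤ ε)
    {S : Set Ω} (hS : MeasurableSet S) :
    μ S ≤ ENNReal.ofReal (Real.exp ε) * ν S + ENNReal.ofReal δ := by
  have hα0 : 0 < α := by linarith
  have hα1 : 0 < α - 1 := by linarith
  have hs : 0 < 1 - 1 / α := by
    rw [sub_pos, div_lt_one hα0]
    exact hα
  have h1 := h (S.indicator 1) (measurable_one.indicator hS)
  have h2 : ∀ x, S.indicator (1 : Ω → ℝ≥0∞) x ^ (α / (α - 1)) = S.indicator 1 x := by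
    intro x
    by_cases hx : x ∈ S
    · simp [hx]
    · simp [hx, div_pos hα0 hα1]
  simp_rw [h2] at h1
  rw [lintegral_indicator_one hS, lintegral_indicator_one hS] at h1
  refine h1.trans ?_
  set Q := (ν S).toReal with hQ
  have hQ0 : 0 ≤ Q := ENNReal.toReal_nonneg
  rw [← ENNReal.ofReal_toReal (measure_ne_top ν S), ← hQ,
    ENNReal.ofReal_rpow_of_nonneg hQ0 hs.le, ← ENNReal.ofReal_mul (Real.exp_pos _).le,
    ← ENNReal.ofReal_mul (Real.exp_pos _).le, ← ENNReal.ofReal_add (by positivity) hδ.le]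
  refine ENNReal.ofReal_le_ofReal ?_
  -- with weights `1 - 1 / α` and `1 / α`, the left side is the geometric mean of
  -- `exp (ρ + log (1 / δ) / (α - 1)) * Q` and `δ`
  have hkey := Real.geom_mean_le_arith_mean2_weighted (w₁ := 1 - 1 / α) (w₂ := 1 / α)
    (p₁ := Real.exp (ρ + Real.log (1 / δ) / (α - 1)) * Q) (p₂ := δ) hs.le (by positivity)
    (by positivity) hδ.le (by ring)
  have heq : Real.exp (ρ * (1 - 1 / α)) * Q ^ (1 - 1 / α)
      = (Real.exp (ρ + Real.log (1 / δ) / (α - 1)) * Q) ^ (1 - 1 / α) * δ ^ (1 / α) := by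
    rw [Real.mul_rpow (Real.exp_pos _).le hQ0, ← Real.exp_mul, Real.rpow_def_of_pos hδ,
      mul_right_comm, ← Real.exp_add]
    congr 2
    rw [Real.log_div one_ne_zero hδ.ne', Real.log_one]
    field_simp
    ring
  rw [heq]
  refine hkey.trans (add_le_add ?_ ?_)
  · calc (1 - 1 / α) * (Real.exp (ρ + Real.log (1 / δ) / (α - 1)) * Q)
        ≤ 1 * (Real.exp (ρ + Real.log (1 / δ) / (α - 1)) * Q) := by
          refine mul_le_mul_of_nonneg_right ?_ (by positivity)
          have : 0 < 1 / α := by positivity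
          linarith
      _ ≤ Real.exp ε * Q := by
          rw [one_mul]
          exact mul_le_mul_of_nonneg_right (Real.exp_le_exp.2 hε) hQ0
  · have : 1 / α ≤ 1 := by linarith
    nlinarith

/-- A moment bound on the likelihood ratio is a bound on the Rényi divergence. -/
theorem MomentBound.renyiBound {β : Measure Ω} {p q : Ω → ℝ} {α : ℕ} (hα : 2 ≤ α) {ρ : ℝ}
    (hp : IsDensity β p) (hq : IsDensity β q)
    (h : MomentBound β p q α (Real.exp (((α : ℝ) - 1) * ρ))) :
    RenyiBound α ρ (β.withDensity fun x => ENNReal.ofReal (p x))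
      (β.withDensity fun x => ENNReal.ofReal (q x)) := by
  intro f hf
  have hα1 : (1 : ℝ) < α := by exact_mod_cast hα
  have hα0 : (0 : ℝ) < α := by linarith
  have hα1' : (α : ℝ) - 1 ≠ 0 := by linarith
  have hconj : ((α : ℝ) / (α - 1)).HolderConjugate α :=
    (Real.HolderConjugate.conjExponent hα1).symm
  have hs : 0 < 1 - 1 / (α : ℝ) := by
    rw [sub_pos, div_lt_one hα0]
    exact hα1
  have h1 : 1 / ((α : ℝ) / (α - 1)) = 1 - 1 / α := by
    field_simp
  have hpm : Measurable fun x => ENNReal.ofReal (p x) := hp.measurable.ennreal_ofReal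
  have hqm : Measurable fun x => ENNReal.ofReal (q x) := hq.measurable.ennreal_ofReal
  rw [lintegral_withDensity_eq_lintegral_mul _ hpm hf,
    lintegral_withDensity_eq_lintegral_mul _ hqm (hf.pow_const _)]
  have hH := ENNReal.lintegral_mul_le_Lp_mul_Lq β hconj
    (f := fun x => f x * ENNReal.ofReal (q x ^ (1 - 1 / (α : ℝ))))
    (g := fun x => ENNReal.ofReal (p x / q x ^ (1 - 1 / (α : ℝ))))
    (hf.mul (hq.measurable.pow_const _).ennreal_ofReal).aemeasurable
    (hp.measurable.div (hq.measurable.pow_const _)).ennreal_ofReal.aemeasurable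
  rw [h1] at hH
  have e1 : ∀ x, (fun x => f x * ENNReal.ofReal (q x ^ (1 - 1 / (α : ℝ)))) x
      * (fun x => ENNReal.ofReal (p x / q x ^ (1 - 1 / (α : ℝ)))) x
        = ENNReal.ofReal (p x) * f x := by
    intro x
    have hqx := Real.rpow_pos_of_pos (hq.pos x) (1 - 1 / (α : ℝ))
    simp only
    rw [mul_assoc, ← ENNReal.ofReal_mul hqx.le, mul_div_cancel₀ _ hqx.ne', mul_comm]
  have e2 : ∀ x, (f x * ENNReal.ofReal (q x ^ (1 - 1 / (α : ℝ)))) ^ ((α : ℝ) / (α - 1))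
      = ENNReal.ofReal (q x) * f x ^ ((α : ℝ) / (α - 1)) := by
    intro x
    have hqx := Real.rpow_pos_of_pos (hq.pos x) (1 - 1 / (α : ℝ))
    rw [ENNReal.mul_rpow_of_nonneg _ _ hconj.nonneg, ENNReal.ofReal_rpow_of_pos hqx,
      ← Real.rpow_mul (hq.pos x).le, ← h1, one_div_mul_cancel hconj.ne_zero, Real.rpow_one,
      mul_comm]
  have e3 : ∀ x, ENNReal.ofReal (p x / q x ^ (1 - 1 / (α : ℝ))) ^ (α : ℝ)
      = ENNReal.ofReal (p x ^ α / q x ^ (α - 1)) := by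
    intro x
    have hqx := Real.rpow_pos_of_pos (hq.pos x) (1 - 1 / (α : ℝ))
    rw [ENNReal.ofReal_rpow_of_pos (div_pos (hp.pos x) hqx), Real.rpow_natCast, div_pow,
      ← Real.rpow_mul_natCast (hq.pos x).le, ← Real.rpow_natCast (q x) (α - 1),
      Nat.cast_sub (by omega)]
    congr 3
    field_simp
    simp
  have e4 : (∫⁻ x, ENNReal.ofReal (p x ^ α / q x ^ (α - 1)) ∂β) ^ (1 / (α : ℝ))
      ≤ ENNReal.ofReal (Real.exp (ρ * (1 - 1 / α))) := by
    rw [← ofReal_integral_eq_lintegral_ofReal h.1 (ae_of_all _ fun x =>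
      div_nonneg (pow_nonneg (hp.pos x).le _) (pow_nonneg (hq.pos x).le _))]
    calc _ ≤ (ENNReal.ofReal (Real.exp (((α : ℝ) - 1) * ρ))) ^ (1 / (α : ℝ)) :=
          ENNReal.rpow_le_rpow (ENNReal.ofReal_le_ofReal h.2) (by positivity)
      _ = _ := by
          rw [ENNReal.ofReal_rpow_of_pos (Real.exp_pos _), ← Real.exp_mul]
          congr 2
          field_simp
  simp only [Pi.mul_apply] at hH ⊢
  simp_rw [e2, e3] at hH
  rw [lintegral_congr e1] at hH
  refine hH.trans ?_
  rw [mul_comm]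
  gcongr

end Renyi

/-! ### Gaussian noise on the sum over a random minibatch -/

section GaussianMix

variable {E : Type*} [NormedAddCommGroup E] [InnerProductSpace ℝ E]

/-- The density, with respect to the standard Gaussian law, of the uniform mixture of its translates
by the vectors `a i`, `i ∈ s`. -/
noncomputable def gaussianMix {ι : Type*} (s : Finset ι) (a : ι → E) (x : E) : ℝ :=
  (s.card : ℝ)⁻¹ * ∑ i ∈ s, shiftDensity (a i) x

/-- A uniform mixture depends only on the distribution of its centres; `k` is the common size of
the fibres. -/
theorem gaussianMix_eq_of_sum_eq {ι ι' : Type*} {s : Finset ι} {t : Finset ι'} {a : ι → E}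
    {a' : ι' → E} {k : ℕ} (hk : 0 < k)
    (h : ∀ g : E → ℝ, ∑ i ∈ s, g (a i) = k * ∑ i ∈ t, g (a' i)) :
    gaussianMix s a = gaussianMix t a' := by
  have hcard : (s.card : ℝ) = k * t.card := by simpa using h fun _ => 1
  have hk' : (k : ℝ) ≠ 0 := by exact_mod_cast hk.ne'
  ext x
  unfold gaussianMix
  rw [h fun c => shiftDensity c x, hcard, mul_inv, mul_mul_mul_comm, inv_mul_cancel₀ hk', one_mul]

variable [FiniteDimensional ℝ E] [MeasurableSpace E] [BorelSpace E]

theorem isDensity_gaussianMix {ι : Type*} {s : Finset ι} (hs : s.Nonempty) (a : ι → E) :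
    IsDensity (stdGaussian E) (gaussianMix s a) where
  measurable := by
    unfold gaussianMix
    exact (Finset.measurable_sum _ fun i _ =>
      (continuous_shiftDensity (a i)).measurable).const_mul _
  pos x := mul_pos (inv_pos.2 (by exact_mod_cast hs.card_pos))
    (Finset.sum_pos (fun i _ => Real.exp_pos _) hs)
  integrable := (integrable_finsetSum _ fun i _ => integrable_shiftDensity (a i)).const_mul _
  integral_eq_one := by
    have hs' : (s.card : ℝ) ≠ 0 := by exact_mod_cast hs.card_pos.ne'
    unfold gaussianMix
    rw [integral_const_mul, integral_finsetSum _ fun i _ => integrable_shiftDensity (a i)]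
    simp [integral_shiftDensity, hs']

/-- Two mixtures whose centres are coupled at distance at most `ρ` have the power divergences of
two Gaussians at distance `ρ`. -/
theorem momentBound_gaussianMix {ι : Type*} {s : Finset ι} (hs : s.Nonempty) {a b : ι → E} {ρ : ℝ}
    (hab : ∀ i ∈ s, ‖a i - b i‖ ≤ ρ) {j : ℕ} (hj : 2 ≤ j) :
    MomentBound (stdGaussian E) (gaussianMix s a) (gaussianMix s b) j
      (Real.exp (((j : ℝ) - 1) * (j * ρ ^ 2 / 2))) := by
  have hj' : (2 : ℝ) ≤ j := by exact_mod_cast hj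
  have hs' : (0 : ℝ) < s.card := by exact_mod_cast hs.card_pos
  have hint : ∀ i ∈ s, Integrable (fun x => (s.card : ℝ)⁻¹ *
      (shiftDensity (a i) x ^ j / shiftDensity (b i) x ^ (j - 1))) (stdGaussian E) := by
    intro i _
    simp_rw [shiftDensity_pow_div_pow (a i) (b i) _ (by omega : 1 ≤ j)]
    exact ((integrable_shiftDensity _).const_mul _).const_mul _
  refine MomentBound.of_le (F := fun x => ∑ i ∈ s, (s.card : ℝ)⁻¹ *
      (shiftDensity (a i) x ^ j / shiftDensity (b i) x ^ (j - 1)))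
    (isDensity_gaussianMix hs a).measurable (isDensity_gaussianMix hs b).measurable
    (fun x => ((isDensity_gaussianMix hs a).pos x).le)
    (fun x => ((isDensity_gaussianMix hs b).pos x).le) (integrable_finsetSum _ hint) ?_ fun x => ?_
  · rw [integral_finsetSum _ hint]
    have hterm : ∀ i ∈ s, ∫ x, (s.card : ℝ)⁻¹ *
        (shiftDensity (a i) x ^ j / shiftDensity (b i) x ^ (j - 1)) ∂(stdGaussian E)
          ≤ (s.card : ℝ)⁻¹ * Real.exp (((j : ℝ) - 1) * (j * ρ ^ 2 / 2)) := by
      intro i hi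
      simp_rw [shiftDensity_pow_div_pow (a i) (b i) _ (by omega : 1 ≤ j)]
      rw [integral_const_mul, integral_const_mul, integral_shiftDensity, mul_one]
      refine mul_le_mul_of_nonneg_left (Real.exp_le_exp.2 ?_) (inv_nonneg.2 hs'.le)
      have hsq := pow_le_pow_left₀ (norm_nonneg _) (hab i hi) 2
      have hjj : (0 : ℝ) ≤ j * (j - 1) / 2 := by
        have : (0 : ℝ) ≤ j * (j - 1) := mul_nonneg (by linarith) (by linarith)
        linarith
      have := mul_le_mul_of_nonneg_left hsq hjj
      linarith
    refine (Finset.sum_le_sum hterm).trans (le_of_eq ?_)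
    rw [Finset.sum_const, nsmul_eq_mul, ← mul_assoc, mul_inv_cancel₀ hs'.ne', one_mul]
  · unfold gaussianMix
    rw [Finset.mul_sum, Finset.mul_sum]
    exact sum_pow_div_sum_pow_le s (fun _ => (s.card : ℝ)⁻¹) _ _ (fun _ _ => inv_nonneg.2 hs'.le)
      (fun _ _ => (Real.exp_pos _).le) (fun _ _ => Real.exp_pos _) (by omega)

/-- The measure with density `gaussianMix s a` is the uniform mixture of translated Gaussians. -/
theorem withDensity_gaussianMix {ι : Type*} {s : Finset ι} (hs : s.Nonempty) (a : ι → E) :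
    ((stdGaussian E).withDensity fun x => ENNReal.ofReal (gaussianMix s a x))
      = ∑ i ∈ s, ((s.card : ℝ≥0∞)⁻¹) • (stdGaussian E).map (fun x => x + a i) := by
  have hs' : (0 : ℝ) < s.card := by exact_mod_cast hs.card_pos
  have hm : ∀ i, Measurable fun x => ENNReal.ofReal (shiftDensity (a i) x) := fun i =>
    (continuous_shiftDensity (a i)).measurable.ennreal_ofReal
  have h : ∀ x, ENNReal.ofReal (gaussianMix s a x)
      = ∑ i ∈ s, (s.card : ℝ≥0∞)⁻¹ * ENNReal.ofReal (shiftDensity (a i) x) := by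
    intro x
    rw [gaussianMix, ENNReal.ofReal_mul (inv_nonneg.2 hs'.le), ENNReal.ofReal_inv_of_pos hs',
      ENNReal.ofReal_natCast, ENNReal.ofReal_sum_of_nonneg (f := fun i => shiftDensity (a i) x)
        fun i _ => (Real.exp_pos _).le, Finset.mul_sum]
  ext S hS
  rw [withDensity_apply _ hS, Measure.finsetSum_apply]
  simp_rw [h]
  rw [lintegral_finsetSum _ fun i _ => (hm i).const_mul _]
  refine Finset.sum_congr rfl fun i _ => ?_
  rw [lintegral_const_mul _ (hm i), Measure.smul_apply, map_add_stdGaussian,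
    withDensity_apply _ hS, smul_eq_mul]

end GaussianMix

section Subsets

/-- Each `(b + 1)`-element set arises from `b + 1` pairs of a `b`-element set and a new element. -/
theorem sum_powersetCard_sum_insert {ι : Type*} [Fintype ι] [DecidableEq ι] (b : ℕ)
    (F : Finset ι → ℝ) :
    ∑ q ∈ (Finset.powersetCard b (Finset.univ : Finset ι)).sigma (fun A => Aᶜ), F (insert q.2 q.1)
      = (b + 1 : ℕ) * ∑ J ∈ Finset.powersetCard (b + 1) Finset.univ, F J := by
  have h : (b + 1 : ℕ) * ∑ J ∈ Finset.powersetCard (b + 1) Finset.univ, F J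
      = ∑ q ∈ (Finset.powersetCard (b + 1) (Finset.univ : Finset ι)).sigma (fun J => J),
          F q.1 := by
    rw [Finset.sum_sigma, Finset.mul_sum]
    refine Finset.sum_congr rfl fun J hJ => ?_
    simp only [Finset.sum_const]
    rw [(Finset.mem_powersetCard.1 hJ).2, nsmul_eq_mul]
  rw [h]
  refine Finset.sum_bij' (fun q _ => ⟨insert q.2 q.1, q.2⟩) (fun q _ => ⟨q.1.erase q.2, q.2⟩)
    ?_ ?_ ?_ ?_ fun _ _ => rfl
  · rintro ⟨A, x⟩ hq
    simp only [Finset.mem_sigma, Finset.mem_powersetCard, Finset.mem_compl] at hq ⊢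
    exact ⟨⟨Finset.subset_univ _, by rw [Finset.card_insert_of_notMem hq.2, hq.1.2]⟩,
      Finset.mem_insert_self _ _⟩
  · rintro ⟨J, x⟩ hq
    simp only [Finset.mem_sigma, Finset.mem_powersetCard, Finset.mem_compl] at hq ⊢
    exact ⟨⟨Finset.subset_univ _, by rw [Finset.card_erase_of_mem hq.2, hq.1.2]; rfl⟩,
      Finset.notMem_erase _ _⟩
  · rintro ⟨A, x⟩ hq
    simp only [Finset.mem_sigma, Finset.mem_compl] at hq
    simp [Finset.erase_insert hq.2]
  · rintro ⟨J, x⟩ hq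
    simp only [Finset.mem_sigma] at hq
    simp [Finset.insert_erase hq.2]

/-- The `(b + 1)`-element subsets are those that avoid `i` and those that contain it. -/
theorem sum_powersetCard_succAbove {E : Type*} [AddCommMonoid E] {N : ℕ} (b : ℕ)
    (v : Fin (N + 1) → E) (i : Fin (N + 1)) (g : E → ℝ) :
    ∑ J ∈ Finset.powersetCard (b + 1) (Finset.univ : Finset (Fin (N + 1))), g (∑ l ∈ J, v l)
      = ∑ J ∈ Finset.powersetCard (b + 1) (Finset.univ : Finset (Fin N)),
          g (∑ l ∈ J, v (i.succAbove l))
        + ∑ A ∈ Finset.powersetCard b (Finset.univ : Finset (Fin N)),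
          g (v i + ∑ l ∈ A, v (i.succAbove l)) := by
  have hi : i ∉ (Finset.univ : Finset (Fin N)).map (Fin.succAboveEmb i) := by
    simp [Fin.succAbove_ne]
  have hiA : ∀ {k : ℕ}, ∀ A ∈ Finset.powersetCard k
      ((Finset.univ : Finset (Fin N)).map (Fin.succAboveEmb i)), i ∉ A := fun A hA h =>
    hi ((Finset.mem_powersetCard.1 hA).1 h)
  rw [Fin.univ_succAbove N i, Finset.cons_eq_insert, Finset.powersetCard_succ_insert hi,
    Finset.sum_union, Finset.sum_image]
  · congr 1
    · rw [Finset.powersetCard_map, Finset.sum_map]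
      refine Finset.sum_congr rfl fun J _ => ?_
      simp [Finset.mapEmbedding_apply, Finset.sum_map]
    · rw [Finset.powersetCard_map, Finset.sum_map]
      refine Finset.sum_congr rfl fun J _ => ?_
      have : i ∉ J.map (Fin.succAboveEmb i) := by simp [Fin.succAbove_ne]
      simp [Finset.mapEmbedding_apply, Finset.sum_insert this, Finset.sum_map]
  · intro A hA A' hA' h
    rw [← Finset.erase_insert (hiA A hA), ← Finset.erase_insert (hiA A' hA'), h]
  · rw [Finset.disjoint_left]
    intro J hJ hJ'
    obtain ⟨A, -, rfl⟩ := Finset.mem_image.1 hJ'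
    exact hiA _ hJ (Finset.mem_insert_self _ _)

end Subsets

section Subsample

variable {E : Type*} [NormedAddCommGroup E] [InnerProductSpace ℝ E]

/-- The density, with respect to the standard Gaussian law, of `ξ + c + ∑ l ∈ J, v l` for a standard
Gaussian `ξ` and an independent uniformly random `b`-element set `J`. -/
noncomputable def subsampleMix {N : ℕ} (b : ℕ) (c : E) (v : Fin N → E) : E → ℝ :=
  gaussianMix (Finset.powersetCard b Finset.univ) fun J => c + ∑ l ∈ J, v l

/-- The entry `i` belongs to a random `(b + 1)`-element minibatch with probability
`(b + 1) / (N + 1)`. -/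
theorem subsampleMix_succ {N : ℕ} {b : ℕ} (hb : b ≤ N) (v : Fin (N + 1) → E) (i : Fin (N + 1))
    (x : E) :
    subsampleMix (b + 1) 0 v x
      = (1 - ((b + 1 : ℕ) : ℝ) / (N + 1 : ℕ))
          * subsampleMix (b + 1) 0 (fun l => v (i.succAbove l)) x
        + ((b + 1 : ℕ) : ℝ) / (N + 1 : ℕ)
          * subsampleMix b (v i) (fun l => v (i.succAbove l)) x := by
  have h1 : (N + 1 : ℝ) * N.choose b = (N + 1).choose (b + 1) * (b + 1) := by
    exact_mod_cast Nat.add_one_mul_choose_eq N b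
  have h2 : ((N + 1).choose (b + 1) : ℝ) = N.choose b + N.choose (b + 1) := by
    exact_mod_cast Nat.choose_succ_succ N b
  have hc0 : (N.choose b : ℝ) ≠ 0 := by exact_mod_cast (Nat.choose_pos hb).ne'
  have hc1 : ((N + 1).choose (b + 1) : ℝ) ≠ 0 := by
    exact_mod_cast (Nat.choose_pos (Nat.succ_le_succ hb)).ne'
  have hN : (N + 1 : ℝ) ≠ 0 := by positivity
  simp only [subsampleMix, gaussianMix, zero_add, Finset.card_powersetCard, Finset.card_univ,
    Fintype.card_fin]
  rw [sum_powersetCard_succAbove b v i fun c => shiftDensity c x, mul_add, ← mul_assoc, ← mul_assoc]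
  push_cast
  congr 1
  · rcases hb.eq_or_lt with rfl | hlt
    · simp [Finset.powersetCard_eq_empty.2]
    · have hc2 : (N.choose (b + 1) : ℝ) ≠ 0 := by exact_mod_cast (Nat.choose_pos hlt).ne'
      congr 1
      rw [eq_mul_inv_iff_mul_eq₀ hc2, inv_mul_eq_div, div_eq_iff hc1]
      field_simp
      linear_combination -(N + 1 : ℝ) * h2 - h1
  · congr 1
    field_simp
    linear_combination h1

/-- Drawing `b` vectors and adding `z` is coupled with drawing `b + 1` vectors: `z` is exchanged for
one further random vector. -/
theorem subsampleMix_eq_gaussianMix_pairs {N b : ℕ} (hb : b < N) (z : E) (v : Fin N → E) :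
    subsampleMix b z v = gaussianMix ((Finset.powersetCard b Finset.univ).sigma fun A => Aᶜ)
        (fun q => z + ∑ l ∈ q.1, v l) ∧
    subsampleMix (b + 1) 0 v
      = gaussianMix ((Finset.powersetCard b Finset.univ).sigma fun A => Aᶜ)
        (fun q => v q.2 + ∑ l ∈ q.1, v l) := by
  constructor
  · refine (gaussianMix_eq_of_sum_eq (k := N - b) (by omega) fun g => ?_).symm
    rw [Finset.sum_sigma, Finset.mul_sum]
    refine Finset.sum_congr rfl fun A hA => ?_
    simp only [Finset.sum_const]
    rw [Finset.card_compl, Fintype.card_fin, (Finset.mem_powersetCard.1 hA).2,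
      nsmul_eq_mul]
  · refine (gaussianMix_eq_of_sum_eq (k := b + 1) (by omega) fun g => ?_).symm
    rw [← sum_powersetCard_sum_insert b fun J => g (0 + ∑ l ∈ J, v l)]
    refine Finset.sum_congr rfl fun q hq => ?_
    rw [Finset.sum_insert (Finset.mem_compl.1 (Finset.mem_sigma.1 hq).2), zero_add]

variable [FiniteDimensional ℝ E] [MeasurableSpace E] [BorelSpace E]

theorem isDensity_subsampleMix {N b : ℕ} (hb : b ≤ N) (c : E) (v : Fin N → E) :
    IsDensity (stdGaussian E) (subsampleMix b c v) :=
  isDensity_gaussianMix (Finset.powersetCard_nonempty.2 (by simpa using hb)) _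

theorem momentBound_subsampleMix_offset {N b : ℕ} (hb : b ≤ N) {c c' : E} {ρ : ℝ}
    (h : ‖c - c'‖ ≤ ρ) (v : Fin N → E) {j : ℕ} (hj : 2 ≤ j) :
    MomentBound (stdGaussian E) (subsampleMix b c v) (subsampleMix b c' v) j
      (Real.exp (((j : ℝ) - 1) * (j * ρ ^ 2 / 2))) :=
  momentBound_gaussianMix (Finset.powersetCard_nonempty.2 (by simpa using hb))
    (fun A _ => by simpa using h) hj

theorem momentBound_subsampleMix_succ {N b : ℕ} (hb : b < N) {z : E} {v : Fin N → E} {ρ : ℝ}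
    (h : ∀ l, ‖z - v l‖ ≤ ρ) {j : ℕ} (hj : 2 ≤ j) :
    MomentBound (stdGaussian E) (subsampleMix b z v) (subsampleMix (b + 1) 0 v) j
      (Real.exp (((j : ℝ) - 1) * (j * ρ ^ 2 / 2))) ∧
    MomentBound (stdGaussian E) (subsampleMix (b + 1) 0 v) (subsampleMix b z v) j
      (Real.exp (((j : ℝ) - 1) * (j * ρ ^ 2 / 2))) := by
  have hne : ((Finset.powersetCard b (Finset.univ : Finset (Fin N))).sigma
      fun A => Aᶜ).Nonempty := by
    obtain ⟨A, hA⟩ := (Finset.powersetCard_nonempty (s := (Finset.univ : Finset (Fin N)))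
      (n := b)).2 (by simpa using hb.le)
    have : (Aᶜ).Nonempty := by
      rw [← Finset.card_pos, Finset.card_compl, Fintype.card_fin, (Finset.mem_powersetCard.1 hA).2]
      omega
    obtain ⟨x, hx⟩ := this
    exact ⟨⟨A, x⟩, Finset.mem_sigma.2 ⟨hA, hx⟩⟩
  obtain ⟨h1, h2⟩ := subsampleMix_eq_gaussianMix_pairs hb z v
  rw [h1, h2]
  refine ⟨momentBound_gaussianMix hne (fun q _ => ?_) hj,
    momentBound_gaussianMix hne (fun q _ => ?_) hj⟩
  · simpa using h q.2
  · simpa [norm_sub_rev] using h q.2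

/-- One noisy sum over a minibatch, when the entry `i` is replaced. -/
theorem momentBound_subsampleMix_replace {N b : ℕ} (hb : b ≤ N) {v v' : Fin (N + 1) → E}
    (i : Fin (N + 1)) (hvv' : ∀ l, v' (i.succAbove l) = v (i.succAbove l)) {ρ : ℝ}
    (h : ∀ l, ‖v i - v l‖ ≤ ρ) (h' : ∀ l, ‖v' i - v l‖ ≤ ρ) {γ : ℝ}
    (hγ : ((b + 1 : ℕ) : ℝ) / (N + 1 : ℕ) ≤ γ) {α : ℕ} (hα : 2 ≤ α) :
    MomentBound (stdGaussian E) (subsampleMix (b + 1) 0 v) (subsampleMix (b + 1) 0 v') α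
      (Real.exp (((α : ℝ) - 1) * subsampledRDP γ (fun j => j * ρ ^ 2 / 2) α)) := by
  have h0 : 0 ≤ ((b + 1 : ℕ) : ℝ) / (N + 1 : ℕ) := by positivity
  have h1 : ((b + 1 : ℕ) : ℝ) / (N + 1 : ℕ) ≤ 1 := by
    rw [div_le_one (by positivity)]
    exact_mod_cast Nat.succ_le_succ hb
  have he : ∀ j : ℕ, 0 ≤ (j : ℝ) * ρ ^ 2 / 2 := fun j => by positivity
  set w : Fin N → E := fun l => v (i.succAbove l) with hw
  have hp := isDensity_subsampleMix hb (v i) w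
  have hq := isDensity_subsampleMix hb (v' i) w
  have hpq : ∀ j : ℕ, 2 ≤ j → MomentBound (stdGaussian E) (subsampleMix b (v i) w)
      (subsampleMix b (v' i) w) j (Real.exp (((j : ℝ) - 1) * (j * ρ ^ 2 / 2))) := fun j hj =>
    momentBound_subsampleMix_offset hb (by simpa [norm_sub_rev] using h' i) w hj
  have e1 := funext (subsampleMix_succ hb v i)
  have e2 := funext (subsampleMix_succ hb v' i)
  simp only [hvv'] at e2
  rw [e1, e2]
  rcases hb.eq_or_lt with rfl | hlt
  · -- every minibatch is the whole dataset: the common component has weight `0`, so any density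
    -- may stand in for it
    have hone : ((b + 1 : ℕ) : ℝ) / (b + 1 : ℕ) = 1 := div_self (by positivity)
    have := momentBound_subsampledRDP he hp hq hq hpq
      (fun j hj => (hq.momentBound_self (by omega)).mono (Real.one_le_exp (mul_nonneg (by
        have : (2 : ℝ) ≤ j := by exact_mod_cast hj
        linarith) (he j)))) hpq h0 h1 hγ hα
    simpa only [hone, sub_self, zero_mul, zero_add, one_mul] using this
  · exact momentBound_subsampledRDP he hp hq (isDensity_subsampleMix hlt 0 w)
      (fun j hj => (momentBound_subsampleMix_succ hlt (fun l => h _) hj).1)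
      (fun j hj => (momentBound_subsampleMix_succ hlt (fun l => h' _) hj).1) hpq h0 h1 hγ hα

/-- One noisy sum over a minibatch, when the entry `i` is inserted or removed. -/
theorem momentBound_subsampleMix_insert {N b : ℕ} (hb : b < N) {v : Fin (N + 1) → E}
    {w : Fin N → E} (i : Fin (N + 1)) (hvw : ∀ l, v (i.succAbove l) = w l) {ρ : ℝ} (hρ : 0 ≤ ρ)
    (h : ∀ l, ‖v i - w l‖ ≤ ρ) {γ : ℝ} (hγ : ((b + 1 : ℕ) : ℝ) / (N + 1 : ℕ) ≤ γ) {α : ℕ}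
    (hα : 2 ≤ α) :
    MomentBound (stdGaussian E) (subsampleMix (b + 1) 0 w) (subsampleMix (b + 1) 0 v) α
      (Real.exp (((α : ℝ) - 1) * subsampledRDP γ (fun j => j * ρ ^ 2 / 2) α)) ∧
    MomentBound (stdGaussian E) (subsampleMix (b + 1) 0 v) (subsampleMix (b + 1) 0 w) α
      (Real.exp (((α : ℝ) - 1) * subsampledRDP γ (fun j => j * ρ ^ 2 / 2) α)) := by
  have h0 : 0 ≤ ((b + 1 : ℕ) : ℝ) / (N + 1 : ℕ) := by positivity
  have h1 : ((b + 1 : ℕ) : ℝ) / (N + 1 : ℕ) ≤ 1 := by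
    rw [div_le_one (by positivity)]
    exact_mod_cast Nat.succ_le_succ hb.le
  have he : ∀ j : ℕ, 0 ≤ (j : ℝ) * ρ ^ 2 / 2 := fun j => by positivity
  have hr := isDensity_subsampleMix hb 0 w
  have hp := isDensity_subsampleMix hb.le (v i) w
  have hrr : ∀ j : ℕ, 2 ≤ j → MomentBound (stdGaussian E) (subsampleMix (b + 1) 0 w)
      (subsampleMix (b + 1) 0 w) j (Real.exp (((j : ℝ) - 1) * (j * ρ ^ 2 / 2))) := fun j hj =>
    momentBound_subsampleMix_offset hb (by simpa using hρ) w hj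
  have hpr := fun (j : ℕ) (hj : 2 ≤ j) => momentBound_subsampleMix_succ hb h hj
  have e1 := funext (subsampleMix_succ hb.le v i)
  simp only [hvw] at e1
  -- without the entry `i`, both components of the mixture are the same
  have e2 : subsampleMix (b + 1) 0 w = fun x =>
      (1 - ((b + 1 : ℕ) : ℝ) / (N + 1 : ℕ)) * subsampleMix (b + 1) 0 w x
        + ((b + 1 : ℕ) : ℝ) / (N + 1 : ℕ) * subsampleMix (b + 1) 0 w x := by
    ext x
    ring
  constructor
  · have := momentBound_subsampledRDP he hr hp hr hrr (fun j hj => (hpr j hj).1)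
      (fun j hj => (hpr j hj).2) h0 h1 hγ hα
    rwa [← e1, ← e2] at this
  · have := momentBound_subsampledRDP he hp hr hr (fun j hj => (hpr j hj).1) hrr
      (fun j hj => (hpr j hj).1) h0 h1 hγ hα
    rwa [← e1, ← e2] at this

end Subsample

/-! ### The distillation algorithm -/

namespace Config

variable {d m c : ℕ} (cfg : Config d m c)

theorem norm_clippedGrad_le (hC : 0 < cfg.clipNorm) (y : Fin m → ℝ) (z : Point d)
    (X : EuclideanSpace ℝ (Fin m × Fin d)) : ‖cfg.clippedGrad y z X‖ ≤ cfg.clipNorm := by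
  set g := cfg.sampleGrad y z X with hg
  have hmax : 0 < max 1 (‖g‖ / cfg.clipNorm) := lt_max_of_lt_left one_pos
  have h : ‖g‖ ≤ cfg.clipNorm * max 1 (‖g‖ / cfg.clipNorm) := by
    rw [← div_le_iff₀' hC]
    exact le_max_right _ _
  rw [clippedGrad, ← hg, norm_smul, norm_inv, Real.norm_of_nonneg hmax.le, inv_mul_le_iff₀ hmax,
    mul_comm]
  exact h

/-- The clipped gradient of the entry `z`, in units of the standard deviation of the noise. -/
noncomputable def scaledGrad (σ : ℝ) (y : Fin m → ℝ) (X : EuclideanSpace ℝ (Fin m × Fin d))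
    (z : Point d) : EuclideanSpace ℝ (Fin m × Fin d) :=
  (σ * cfg.clipNorm)⁻¹ • cfg.clippedGrad y z X

theorem norm_scaledGrad_sub_le (hC : 0 < cfg.clipNorm) {σ : ℝ} (hσ : 0 < σ) (y : Fin m → ℝ)
    (X : EuclideanSpace ℝ (Fin m × Fin d)) (z z' : Point d) :
    ‖cfg.scaledGrad σ y X z - cfg.scaledGrad σ y X z'‖ ≤ 2 / σ := by
  rw [scaledGrad, scaledGrad, ← smul_sub, norm_smul, norm_inv,
    Real.norm_of_nonneg (mul_pos hσ hC).le, inv_mul_le_iff₀ (mul_pos hσ hC)]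
  have h1 := norm_sub_le (cfg.clippedGrad y z X) (cfg.clippedGrad y z' X)
  have h2 := cfg.norm_clippedGrad_le hC y z X
  have h3 := cfg.norm_clippedGrad_le hC y z' X
  have : σ * cfg.clipNorm * (2 / σ) = 2 * cfg.clipNorm := by field_simp
  linarith

/-- The SGD step, as a function of the noisy sum in units of the standard deviation. -/
noncomputable def postprocess (σ : ℝ) (p : ℕ) (X u : EuclideanSpace ℝ (Fin m × Fin d)) :
    EuclideanSpace ℝ (Fin m × Fin d) :=
  X - (cfg.stepSize p / cfg.batch) • (σ * cfg.clipNorm) • u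

theorem measurable_postprocess (σ : ℝ) (p : ℕ) (X : EuclideanSpace ℝ (Fin m × Fin d)) :
    Measurable (cfg.postprocess σ p X) := by
  unfold postprocess
  fun_prop

/-- One iteration post-processes the Gaussian mechanism applied to a random minibatch. -/
theorem step_eq_map (hC : 0 < cfg.clipNorm) {σ : ℝ} (hσ : 0 < σ) (y : Fin m → ℝ)
    (D : Dataset (Point d)) (hD : cfg.batch ≤ D.1) (p : ℕ)
    (X : EuclideanSpace ℝ (Fin m × Fin d)) :
    cfg.step σ y D p X
      = ((stdGaussian (EuclideanSpace ℝ (Fin m × Fin d))).withDensity fun u => ENNReal.ofReal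
          (subsampleMix cfg.batch 0 (fun l => cfg.scaledGrad σ y X (D.2 l)) u)).map
        (cfg.postprocess σ p X) := by
  have hT := cfg.measurable_postprocess σ p X
  have hs : σ * cfg.clipNorm ≠ 0 := (mul_pos hσ hC).ne'
  unfold subsampleMix
  rw [withDensity_gaussianMix (Finset.powersetCard_nonempty.2 (by simpa using hD))]
  ext S hS
  rw [Measure.map_apply hT hS, Measure.finsetSum_apply]
  change (∑ J ∈ Finset.powersetCard cfg.batch (Finset.univ : Finset (Fin D.1)),
    ((D.1.choose cfg.batch : ℝ≥0∞)⁻¹) •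
      (stdGaussian (EuclideanSpace ℝ (Fin m × Fin d))).map (cfg.update σ y D p J X)) S = _
  rw [Measure.finsetSum_apply]
  refine Finset.sum_congr rfl fun J _ => ?_
  have hu : Measurable (cfg.update σ y D p J X) :=
    (cfg.measurable_update σ y D p J).comp measurable_prodMk_left
  rw [Measure.smul_apply, Measure.smul_apply, Finset.card_powersetCard, Finset.card_univ,
    Fintype.card_fin, Measure.map_apply hu hS, Measure.map_apply (by fun_prop) (hT hS)]
  congr 2
  ext ξ
  have : cfg.update σ y D p J X ξ
      = cfg.postprocess σ p X (ξ + (0 + ∑ l ∈ J, cfg.scaledGrad σ y X (D.2 l))) := by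
    simp only [update, postprocess, scaledGrad, zero_add, ← Finset.smul_sum, smul_add,
      smul_inv_smul₀ hs]
    rw [add_comm]
  simp only [Set.mem_preimage, this]

theorem isProbabilityMeasure_step (σ : ℝ) (y : Fin m → ℝ) (D : Dataset (Point d))
    (hD : cfg.batch ≤ D.1) (p : ℕ) (X : EuclideanSpace ℝ (Fin m × Fin d)) :
    IsProbabilityMeasure (cfg.step σ y D p X) := by
  constructor
  change (∑ J ∈ Finset.powersetCard cfg.batch (Finset.univ : Finset (Fin D.1)),
    ((D.1.choose cfg.batch : ℝ≥0∞)⁻¹) •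
      (stdGaussian (EuclideanSpace ℝ (Fin m × Fin d))).map (cfg.update σ y D p J X)) Set.univ = 1
  rw [Measure.finsetSum_apply]
  have h : ∀ J ∈ Finset.powersetCard cfg.batch (Finset.univ : Finset (Fin D.1)),
      (((D.1.choose cfg.batch : ℝ≥0∞)⁻¹) • (stdGaussian (EuclideanSpace ℝ (Fin m × Fin d))).map
        (cfg.update σ y D p J X)) Set.univ = (D.1.choose cfg.batch : ℝ≥0∞)⁻¹ := by
    intro J _
    have hu : Measurable (cfg.update σ y D p J X) :=
      (cfg.measurable_update σ y D p J).comp measurable_prodMk_left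
    have := Measure.isProbabilityMeasure_map hu.aemeasurable
      (μ := stdGaussian (EuclideanSpace ℝ (Fin m × Fin d)))
    rw [Measure.smul_apply, measure_univ, smul_eq_mul, mul_one]
  rw [Finset.sum_congr rfl h, Finset.sum_const, Finset.card_powersetCard, Finset.card_univ,
    Fintype.card_fin, nsmul_eq_mul]
  exact ENNReal.mul_inv_cancel (by exact_mod_cast (Nat.choose_pos hD).ne')
    (ENNReal.natCast_ne_top _)

theorem isProbabilityMeasure_inputsLaw (σ : ℝ) (y : Fin m → ℝ) (D : Dataset (Point d))
    (hD : cfg.batch ≤ D.1) (p : ℕ) : IsProbabilityMeasure (cfg.inputsLaw σ y D p) := by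
  induction p with
  | zero => exact isProbabilityMeasure_stdGaussian
  | succ p ih =>
    have : IsMarkovKernel (cfg.step σ y D p) :=
      ⟨fun X => cfg.isProbabilityMeasure_step σ y D hD p X⟩
    unfold inputsLaw
    infer_instance

theorem measurable_labelled (y : Fin m → ℝ) :
    Measurable fun (X : EuclideanSpace ℝ (Fin m × Fin d)) (j : Fin m) => (row X j, y j) := by
  refine measurable_pi_lambda _ fun j => Measurable.prodMk ?_ measurable_const
  unfold row
  fun_prop

theorem sum_label_weights (hc : 1 ≤ c) : ∑ _u : Fin m → Fin c, (((c : ℝ≥0∞) ^ m)⁻¹) = 1 := by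
  rw [Finset.sum_const, Finset.card_univ, Fintype.card_fun, Fintype.card_fin, Fintype.card_fin,
    nsmul_eq_mul, Nat.cast_pow]
  have hc' : (c : ℝ≥0∞) ≠ 0 := by exact_mod_cast (by omega : c ≠ 0)
  exact ENNReal.mul_inv_cancel (pow_ne_zero _ hc') (by finiteness)

theorem isProbabilityMeasure_outputLaw (hc : 1 ≤ c) (σ : ℝ) (D : Dataset (Point d))
    (hD : cfg.batch ≤ D.1) : IsProbabilityMeasure (cfg.outputLaw σ D) := by
  constructor
  rw [outputLaw, Measure.finsetSum_apply, ← sum_label_weights (m := m) hc]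
  refine Finset.sum_congr rfl fun u _ => ?_
  have := cfg.isProbabilityMeasure_inputsLaw σ (cfg.classLabel ∘ u) D hD cfg.iterations
  have := Measure.isProbabilityMeasure_map (μ := cfg.inputsLaw σ (cfg.classLabel ∘ u) D
    cfg.iterations) (measurable_labelled (d := d) (cfg.classLabel ∘ u)).aemeasurable
  rw [Measure.smul_apply]
  change _ • (Measure.map (fun X j => (row X j, (cfg.classLabel ∘ u) j)) _) Set.univ = _
  rw [measure_univ, smul_eq_mul, mul_one]

theorem gaussianRDP_noise (hC : 0 < cfg.clipNorm) (σ : ℝ) :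
    gaussianRDP (2 * cfg.clipNorm) (σ * cfg.clipNorm) = fun j : ℕ => (j : ℝ) * (2 / σ) ^ 2 / 2 := by
  ext j
  unfold gaussianRDP
  have := hC.ne'
  rw [mul_pow, mul_pow, div_pow]
  by_cases hσ : σ = 0
  · simp [hσ]
  · field_simp

/-- The Rényi divergence bound of one iteration, for neighbouring datasets. The larger of them has
size at least `n`, so the entry in which they differ is drawn with probability at most `B / n`. -/
theorem renyiBound_step (hC : 0 < cfg.clipNorm) (hB : 1 ≤ cfg.batch) {n : ℕ} {σ : ℝ} (hσ : 0 < σ)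
    {D D' : Dataset (Point d)} (hn : Neighbors D D') (hsize : D.1 = n ∨ D'.1 = n) (hn1 : 1 ≤ n)
    (hD : cfg.batch ≤ D.1) (hD' : cfg.batch ≤ D'.1) {α : ℕ} (hα : 2 ≤ α) (y : Fin m → ℝ) (p : ℕ)
    (X : EuclideanSpace ℝ (Fin m × Fin d)) :
    RenyiBound α (subsampledRDP ((cfg.batch : ℝ) / n)
      (gaussianRDP (2 * cfg.clipNorm) (σ * cfg.clipNorm)) α)
      (cfg.step σ y D p X) (cfg.step σ y D' p X) := by
  rw [cfg.step_eq_map hC hσ y D hD, cfg.step_eq_map hC hσ y D' hD', cfg.gaussianRDP_noise hC]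
  refine RenyiBound.map ?_ (cfg.measurable_postprocess σ p X)
  refine MomentBound.renyiBound hα (isDensity_subsampleMix hD _ _)
    (isDensity_subsampleMix hD' _ _) ?_
  obtain ⟨b, hb⟩ : ∃ b, cfg.batch = b + 1 := ⟨cfg.batch - 1, by omega⟩
  rw [hb] at hD hD' ⊢
  have hdiff := cfg.norm_scaledGrad_sub_le hC hσ y X
  have hrate : ∀ N : ℕ, n ≤ N → ((b + 1 : ℕ) : ℝ) / N ≤ ((b + 1 : ℕ) : ℝ) / n := fun N hN =>
    div_le_div_of_nonneg_left (by positivity) (by exact_mod_cast hn1) (by exact_mod_cast hN)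
  have hρ : 0 ≤ 2 / σ := by positivity
  cases hn with
  | @replace k D i z =>
    simp only [or_self] at hsize hD
    obtain ⟨N, rfl⟩ : ∃ N, k = N + 1 := ⟨k - 1, by omega⟩
    exact momentBound_subsampleMix_replace (by omega) i
      (fun l => by simp)
      (fun l => hdiff _ _) (fun l => hdiff _ _) (hrate _ hsize.ge) hα
  | @insert k D i z =>
    simp only at hsize hD hD'
    exact (momentBound_subsampleMix_insert (by omega) i (fun l => by simp) hρ
      (fun l => hdiff _ _) (hrate _ (by omega)) hα).1
  | @remove k D i z =>
    simp only at hsize hD hD'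
    exact (momentBound_subsampleMix_insert (by omega) i (fun l => by simp) hρ
      (fun l => hdiff _ _) (hrate _ (by omega)) hα).2

theorem renyiBound_inputsLaw {σ α ρ : ℝ} (hα : 1 < α) {D D' : Dataset (Point d)}
    (y : Fin m → ℝ)
    (h : ∀ p X, RenyiBound α ρ (cfg.step σ y D p X) (cfg.step σ y D' p X)) (p : ℕ) :
    RenyiBound α (p * ρ) (cfg.inputsLaw σ y D p) (cfg.inputsLaw σ y D' p) := by
  induction p with
  | zero =>
    rw [Nat.cast_zero, zero_mul]
    exact RenyiBound.refl hα (stdGaussian (EuclideanSpace ℝ (Fin m × Fin d)))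
  | succ p ih =>
    have := ih.bind hα (h p)
    rwa [show ((p + 1 : ℕ) : ℝ) * ρ = p * ρ + ρ by push_cast; ring]

/-- A large order makes the conversion term small, and then a large noise parameter makes the
Rényi divergences small. -/
theorem exists_calibrated (hC : 0 < cfg.clipNorm) (n : ℕ) {ε δ : ℝ} (hε : 0 < ε) :
    ∃ σ : ℝ, 0 < σ ∧ cfg.Calibrated n ε δ σ := by
  obtain ⟨k, hk⟩ := exists_nat_ge (Real.log (1 / δ) / (ε / 2))
  set α := k + 2 with hα
  set P := (cfg.iterations : ℝ) with hP
  have hP0 : 0 ≤ P := Nat.cast_nonneg _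
  have hα1 : (0 : ℝ) < (α : ℝ) - 1 := by rw [hα]; push_cast; linarith [Nat.cast_nonneg (α := ℝ) k]
  have h1 : Real.log (1 / δ) / ((α : ℝ) - 1) ≤ ε / 2 := by
    rw [div_le_iff₀ (by linarith)] at hk
    rw [div_le_iff₀ hα1]
    have : (k : ℝ) * (ε / 2) ≤ ((α : ℝ) - 1) * (ε / 2) :=
      mul_le_mul_of_nonneg_right (by rw [hα]; push_cast; linarith) (by linarith)
    linarith
  set A := 4 * P * α / ε with hA
  have hA0 : 0 ≤ A := by positivity
  refine ⟨A + 1, by linarith, α, by omega, ?_⟩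
  rw [cfg.gaussianRDP_noise hC]
  have h2 : P * subsampledRDP ((cfg.batch : ℝ) / n) (fun j : ℕ => (j : ℝ) * (2 / (A + 1)) ^ 2 / 2) α
      ≤ P * ((α : ℝ) * (2 / (A + 1)) ^ 2 / 2) :=
    mul_le_mul_of_nonneg_left (min_le_left _ _) hP0
  have h3 : P * ((α : ℝ) * (2 / (A + 1)) ^ 2 / 2) ≤ ε / 2 := by
    have hA1 : 0 < A + 1 := by linarith
    have e : P * ((α : ℝ) * (2 / (A + 1)) ^ 2 / 2) = (ε / 2) * (A / (A + 1) ^ 2) := by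
      rw [hA]
      field_simp
      ring
    rw [e]
    have : A / (A + 1) ^ 2 ≤ 1 := by
      rw [div_le_one (by positivity)]
      nlinarith
    nlinarith
  linarith

theorem isDifferentiallyPrivate_outputLaw (hc : 1 ≤ c) (hC : 0 < cfg.clipNorm)
    (hB : 1 ≤ cfg.batch) {n : ℕ} (hn1 : 1 ≤ n) {ε δ σ : ℝ} (hδ : 0 < δ) (hσ : 0 < σ)
    (hcal : cfg.Calibrated n ε δ σ) :
    IsDifferentiallyPrivate (cfg.outputLaw σ)
      (fun D D' => Neighbors D D' ∧ (D.1 = n ∨ D'.1 = n) ∧ cfg.batch ≤ D.1 ∧ cfg.batch ≤ D'.1)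
      ε δ := by
  rintro D D' ⟨hn, hsize, hD, hD'⟩ S hS
  obtain ⟨α, hα, hcert⟩ := hcal
  have hα1 : (1 : ℝ) < α := by exact_mod_cast hα
  have key : ∀ u : Fin m → Fin c,
      ((cfg.inputsLaw σ (cfg.classLabel ∘ u) D cfg.iterations).map
          (fun X j => (row X j, cfg.classLabel (u j)))) S
        ≤ ENNReal.ofReal (Real.exp ε) * ((cfg.inputsLaw σ (cfg.classLabel ∘ u) D'
          cfg.iterations).map (fun X j => (row X j, cfg.classLabel (u j)))) S
          + ENNReal.ofReal δ := by
    intro u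
    have hm : Measurable fun (X : EuclideanSpace ℝ (Fin m × Fin d)) (j : Fin m) =>
        (row X j, cfg.classLabel (u j)) := measurable_labelled (cfg.classLabel ∘ u)
    have := cfg.isProbabilityMeasure_inputsLaw σ (cfg.classLabel ∘ u) D' hD' cfg.iterations
    have := Measure.isProbabilityMeasure_map (μ := cfg.inputsLaw σ (cfg.classLabel ∘ u) D'
      cfg.iterations) hm.aemeasurable
    exact ((cfg.renyiBound_inputsLaw hα1 (cfg.classLabel ∘ u) (cfg.renyiBound_step hC hB hσ hn
      hsize hn1 hD hD' hα _) cfg.iterations).map hm).measure_le hα1 hδ hcert hS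
  rw [outputLaw, outputLaw, Measure.finsetSum_apply, Measure.finsetSum_apply]
  simp only [Measure.smul_apply, smul_eq_mul]
  calc _ ≤ ∑ u : Fin m → Fin c, (((c : ℝ≥0∞) ^ m)⁻¹) * (ENNReal.ofReal (Real.exp ε)
          * ((cfg.inputsLaw σ (cfg.classLabel ∘ u) D' cfg.iterations).map
            (fun X j => (row X j, cfg.classLabel (u j)))) S + ENNReal.ofReal δ) :=
        Finset.sum_le_sum fun u _ => mul_le_mul_right (key u) _
    _ = _ := by
        simp_rw [mul_add]
        rw [Finset.sum_add_distrib, ← Finset.sum_mul, sum_label_weights hc, one_mul,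
          Finset.mul_sum]
        congr 1
        exact Finset.sum_congr rfl fun u _ => mul_left_comm _ _ _

end Config

end DPKIP

theorem mainTheorem1 (d m c : ℕ) (hc : 1 ≤ c) (cfg : DPKIP.Config d m c)
    (hC : 0 < cfg.clipNorm) (n : ℕ) (hB : 1 ≤ cfg.batch) (hBn : cfg.batch ≤ n)
    (ε δ : ℝ) (hε : 0 < ε) (hδ : 0 < δ) (hδ1 : δ < 1) :
    (∃ σ : ℝ, 0 < σ ∧ cfg.Calibrated n ε δ σ) ∧
    ∀ σ : ℝ, 0 < σ → cfg.Calibrated n ε δ σ →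
      (∀ D : DPKIP.Dataset (DPKIP.Point d), cfg.batch ≤ D.1 →
        MeasureTheory.IsProbabilityMeasure (cfg.outputLaw σ D)) ∧
      DPKIP.IsDifferentiallyPrivate (cfg.outputLaw σ)
        (fun D D' => DPKIP.Neighbors D D' ∧ (D.1 = n ∨ D'.1 = n) ∧
          cfg.batch ≤ D.1 ∧ cfg.batch ≤ D'.1) ε δ :=
  ⟨cfg.exists_calibrated hC n hε, fun σ hσ hcal =>
    ⟨fun D hD => cfg.isProbabilityMeasure_outputLaw hc σ D hD,
      cfg.isDifferentiallyPrivate_outputLaw hc hC hB (hB.trans hBn) hδ hσ hcal⟩⟩
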